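/- All graphs are finite, simple and undirected. In the game of Cops and Robber with one cop, the cop chooses a starting vertex, then the robber chooses one, and then the two players take turns (cop first), each moving to an adjacent vertex or staying put. A graph is cop-win if the cop has a strategy that guarantees that, after finitely many moves, she occupies the same vertex as the robber. For a graph $G$ of order $n$ and $1\le k\le n$, let $W_k(G)$ be the number of $k$-element sets of vertices of $G$ that induce a cop-win subgraph, and let $$\operatorname{CW}(G,x)=\sum_{k=1}^{n}W_k(G)\,x^k$$ be the cop-win polynomial of $G$. A graph is bicyclic if it is connected and $|E(G)|=|V(G)|+1$. For $n\ge 4$ let $B_n$ be the graph on $n$ vertices obtained from the star $K_{1,n-1}$ by choosing three of its leaves $a,b,c$ and adding the edges $ab$ and $ac$; equivalently, $B_n$ is obtained from $U_{n-1}=(K_2\cup\overline{K_{n-4}})\vee K_1$ by joining a new vertex to the universal vertex and to one of the two vertices of degree $2$. For polynomials $A(x)$ and $B(x)$ write $B(x)\preceq A(x)$ if $\deg B\le\deg A$ and every coefficient of $B$ is at most the corresponding coefficient of $A$. **Theorem.** If $G$ is a bicyclic graph of order $n\ge 7$, then $$\operatorname{CW}(G,x)\preceq\operatorname{CW}(B_n,x).$$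 -/

import Mathlib

open Polynomial

/-- One move in the game of Cops and Robber: stay at the current vertex or go to an adjacent one. -/
def CopMove {V : Type*} (G : SimpleGraph V) (u v : V) : Prop :=
  v = u ∨ G.Adj u v

/-- A strategy for a single cop. `pos h` is the cop's position when the list of positions the
robber has occupied so far is `h`, most recent first. Thus `pos []` is the cop's starting vertex,
chosen before the robber is placed, and `pos (r :: h)` is the cop's reply to the robber's latest
position `r`, which has to be a legal move from the cop's previous position `pos h`. -/
structure CopStrategy {V : Type*} (G : SimpleGraph V) where
  pos : List V → V
  legal : ∀ (r : V) (h : List V), CopMove G (pos h) (pos (r :: h))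

/-- The positions `r (t-1), …, r 1, r 0` of the robber before time `t`, most recent first. -/
def robberHistory {V : Type*} (r : ℕ → V) : ℕ → List V
  | 0 => []
  | t + 1 => r t :: robberHistory r t

/-- `G` is cop-win: one cop has a strategy that captures the robber, whatever he does.
In round `t` the robber is put on `r t` (his initial placement if `t = 0`, a legal move afterwards)
while the cop stands on `pos (robberHistory r t)`, and then the cop moves to
`pos (robberHistory r (t + 1))`. The robber is caught when he is on the cop's vertex after either
player's action. -/
def IsCopWin {V : Type*} (G : SimpleGraph V) : Prop :=
  ∃ σ : CopStrategy G, ∀ r : ℕ → V, (∀ t, CopMove G (r t) (r (t + 1))) →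
    ∃ t, σ.pos (robberHistory r t) = r t ∨ σ.pos (robberHistory r (t + 1)) = r t

open Classical in
/-- `W_k(G)`: the number of `k`-element vertex sets that induce a cop-win subgraph of `G`. -/
noncomputable def copWinCount {V : Type*} [Fintype V] (G : SimpleGraph V) (k : ℕ) : ℕ :=
  ((Finset.univ.powersetCard k).filter
    (fun S : Finset V => IsCopWin (G.induce (S : Set V)))).card

/-- The cop-win polynomial `CW(G, x) = ∑_{k=1}^{n} W_k(G) x^k`, where `n` is the order of `G`. -/
noncomputable def copWinPolynomial {V : Type*} [Fintype V] (G : SimpleGraph V) : ℤ[X] :=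
  ∑ k ∈ Finset.Icc 1 (Fintype.card V), C (copWinCount G k : ℤ) * X ^ k

/-- `CoeffLE B A` is the relation `B ⪯ A`: the degree of `B` is at most that of `A`, and every
coefficient of `B` is at most the corresponding coefficient of `A`. -/
def CoeffLE (B A : ℤ[X]) : Prop :=
  B.natDegree ≤ A.natDegree ∧ ∀ k : ℕ, B.coeff k ≤ A.coeff k

/-- A finite graph is bicyclic if it is connected and has one more edge than it has vertices. -/
def IsBicyclic {V : Type*} [Fintype V] (G : SimpleGraph V) : Prop :=
  G.Connected ∧ G.edgeSet.ncard = Fintype.card V + 1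

/-- The graph `B_n` (for `n ≥ 4`) on `{0, …, n - 1}`. Vertex `0` is universal and `1` is moreover
adjacent to `2` and `3`; there are no further edges. Without vertex `3` it is
`U_{n-1} = (K_2 ∪ (n - 4) K_1) ∨ K_1`, in which `1` and `2` have degree `2`, and the new vertex `3`
is joined to the universal vertex `0` and to `1`. -/
def graphB (n : ℕ) : SimpleGraph (Fin n) :=
  SimpleGraph.fromRel fun i j =>
    i.val = 0 ∨ (i.val = 1 ∧ (j.val = 2 ∨ j.val = 3))

set_option linter.unusedSectionVars false

/-! A robber on an induced cycle of length at least four escapes forever unless some vertex off the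
cycle has three neighbours on it. In a bicyclic graph there is no such vertex, since it would give a
subgraph of circuit rank three. So cop-win sets are connected and hole-free (`Good.of_isCopWin`),
and it suffices to count such sets. In `graphB n` every `k`-set through the universal vertex is
cop-win, which gives `(n - 1).choose (k - 1)` sets, and a few small sets come on top
(`le_copWinCount_graphB`). The matching upper bounds are `wcount_three_bicyclic` for triples and
`wcount_bicyclic` for larger sets.

These are proved by induction on the order: one vertex `v` is removed, and the good sets avoiding
`v` and those through `v` are matched with the two terms of Pascal's rule. If `v` is pendant, the
sets through it also contain its neighbour. If the minimum degree is two, `v` is taken of degree two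
with a neighbour of degree two. The sets through `v` inject into the good sets of the graph in which
`v` is suppressed, which is again bicyclic unless `v` lies on a triangle. The sets avoiding `v` live
in a unicyclic graph that is not a cycle (`wcount_unicyclic`) or, if `v` is a cut vertex, stay good
in the suppressed graph (`wcount_core_step`).

Minimum degree two and order five to seven is settled by kernel computation. At order six the bound
on four-sets is allowed to fail by one; attaching a pendant vertex wins this back. Triples need an
allowance at small orders that has vanished at order seven. -/

open Classical in
/-- The neighbours of `x` inside `A`. -/
noncomputable def nbrIn {V : Type*} (G : SimpleGraph V) (A : Finset V) (x : V) : Finset V :=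
  A.filter fun y => G.Adj x y

/-- The degree of `x` into `A`. -/
noncomputable def degIn {V : Type*} (G : SimpleGraph V) (A : Finset V) (x : V) : ℕ :=
  (nbrIn G A x).card

/-- The sum of the degrees of the subgraph induced by `A`. -/
noncomputable def degSum {V : Type*} (G : SimpleGraph V) (A : Finset V) : ℕ :=
  ∑ x ∈ A, degIn G A x

/-- `A` induces a connected subgraph: every nontrivial cut is crossed by an edge. -/
def ConnSet {V : Type*} (G : SimpleGraph V) (A : Finset V) : Prop :=
  ∀ T ⊆ A, T.Nonempty → T ≠ A → ∃ x ∈ T, ∃ y ∈ A, y ∉ T ∧ G.Adj x y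

/-- `H` induces a disjoint union of cycles of length at least four. -/
def Hole {V : Type*} (G : SimpleGraph V) (H : Finset V) : Prop :=
  H.Nonempty ∧ ∀ x ∈ H, ∃ y ∈ H, ∃ z ∈ H, y ≠ z ∧ G.Adj x y ∧ G.Adj x z ∧ ¬ G.Adj y z ∧
    ∀ t ∈ H, G.Adj x t → t = y ∨ t = z

/-- `S` is connected and contains no hole. -/
def Good {V : Type*} (G : SimpleGraph V) (S : Finset V) : Prop :=
  ConnSet G S ∧ ∀ H ⊆ S, ¬ Hole G H

open Classical in
/-- The number of good `k`-subsets of `A`. -/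
noncomputable def wcount {V : Type*} (G : SimpleGraph V) (A : Finset V) (k : ℕ) : ℕ :=
  ((A.powersetCard k).filter fun S => Good G S).card

open Classical in
/-- The number of good `k`-subsets of `A` that contain `v`. -/
noncomputable def wcountAt {V : Type*} (G : SimpleGraph V) (A : Finset V) (k : ℕ) (v : V) : ℕ :=
  ((A.powersetCard k).filter fun S => v ∈ S ∧ Good G S).card


/-! ### Degrees, connectivity and pendant vertices. -/

section basics
variable {V : Type*} [DecidableEq V] {G G' : SimpleGraph V} {A B S H : Finset V} {u v w x y : V}
  {k : ℕ}

lemma mem_nbrIn : y ∈ nbrIn G A x ↔ y ∈ A ∧ G.Adj x y := by simp [nbrIn]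

lemma nbrIn_mono (h : B ⊆ A) : nbrIn G B x ⊆ nbrIn G A x := by
  intro y; simp only [mem_nbrIn]; exact fun ⟨h1, h2⟩ => ⟨h h1, h2⟩

lemma degIn_mono (h : B ⊆ A) : degIn G B x ≤ degIn G A x := Finset.card_le_card (nbrIn_mono h)

lemma nbrIn_erase : nbrIn G (A.erase v) x = (nbrIn G A x).erase v := by
  ext y; simp only [mem_nbrIn, Finset.mem_erase]; tauto

lemma degIn_erase_of_adj (hv : v ∈ A) (h : G.Adj x v) :
    degIn G (A.erase v) x + 1 = degIn G A x := by
  unfold degIn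
  rw [nbrIn_erase]
  exact Finset.card_erase_add_one (mem_nbrIn.2 ⟨hv, h⟩)

lemma degIn_erase_of_not_adj (h : ¬ G.Adj x v) : degIn G (A.erase v) x = degIn G A x := by
  unfold degIn
  rw [nbrIn_erase, Finset.erase_eq_of_notMem]
  simp [mem_nbrIn, h]

lemma degSum_erase (hv : v ∈ A) : degSum G (A.erase v) + 2 * degIn G A v = degSum G A := by
  classical
  have h1 : degSum G A = degIn G A v + ∑ x ∈ A.erase v, degIn G A x :=
    (Finset.add_sum_erase A (degIn G A) hv).symm
  have h2 : ∀ x ∈ A.erase v, degIn G A x = degIn G (A.erase v) x + if G.Adj v x then 1 else 0 := by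
    intro x _
    split_ifs with h
    · exact (degIn_erase_of_adj hv h.symm).symm
    · rw [degIn_erase_of_not_adj fun h' => h h'.symm, add_zero]
  have h3 : ∑ x ∈ A.erase v, (if G.Adj v x then 1 else 0) = degIn G A v := by
    rw [← Finset.sum_filter, ← Finset.card_eq_sum_ones]
    unfold degIn
    congr 1
    ext y
    simp only [Finset.mem_filter, Finset.mem_erase, mem_nbrIn]
    constructor
    · tauto
    · rintro ⟨h, h'⟩; exact ⟨⟨h'.ne', h⟩, h'⟩
  rw [h1, Finset.sum_congr rfl h2, Finset.sum_add_distrib, h3]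
  unfold degSum
  ring

lemma degSum_insert (hv : v ∉ A) : degSum G (insert v A) = degSum G A + 2 * degIn G A v := by
  have h := degSum_erase (G := G) (Finset.mem_insert_self v A)
  rw [Finset.erase_insert hv] at h
  rw [← h]
  congr 2
  have : degIn G ((insert v A).erase v) v = degIn G (insert v A) v :=
    degIn_erase_of_not_adj (G.irrefl)
  rw [← this, Finset.erase_insert hv]

lemma degIn_pos_iff : 0 < degIn G A x ↔ ∃ y ∈ A, G.Adj x y := by
  unfold degIn
  rw [Finset.card_pos]
  constructor
  · rintro ⟨y, hy⟩; exact ⟨y, mem_nbrIn.1 hy⟩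
  · rintro ⟨y, hy⟩; exact ⟨y, mem_nbrIn.2 hy⟩

lemma ConnSet.degIn_pos (h : ConnSet G A) (hx : x ∈ A) (hA : 2 ≤ A.card) : 0 < degIn G A x := by
  rw [degIn_pos_iff]
  obtain ⟨a, ha, y, hy, -, hadj⟩ := h {x} (by simpa using hx) (by simp) (by
    rintro rfl; simp at hA)
  simp only [Finset.mem_singleton] at ha
  subst ha
  exact ⟨y, hy, hadj⟩

/-- In a connected graph the circuit rank is monotone. -/
lemma ConnSet.degSum_le (h : ConnSet G A) (hB : B ⊆ A) (hne : B.Nonempty) :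
    degSum G B + 2 * A.card ≤ degSum G A + 2 * B.card := by
  induction hm : A.card - B.card generalizing B with
  | zero =>
    have : B = A := Finset.eq_of_subset_of_card_le hB (by omega)
    subst this
    exact le_rfl
  | succ m ih =>
    have hBA : B ≠ A := by rintro rfl; omega
    obtain ⟨x, hx, y, hy, hyB, hadj⟩ := h B hB hne hBA
    -- Absorbing an adjacent vertex adds one vertex and at least one edge.
    have h1 := ih (B := insert y B) (Finset.insert_subset hy hB) (by simp)
      (by rw [Finset.card_insert_of_notMem hyB]; omega)
    rw [degSum_insert hyB, Finset.card_insert_of_notMem hyB] at h1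
    have : 0 < degIn G B y := degIn_pos_iff.2 ⟨x, hx, hadj.symm⟩
    omega

lemma ConnSet.congr (h : ∀ x ∈ S, ∀ y ∈ S, G.Adj x y ↔ G'.Adj x y) (hS : ConnSet G S) :
    ConnSet G' S := by
  intro T hT h1 h2
  obtain ⟨x, hx, y, hy, hyT, hadj⟩ := hS T hT h1 h2
  exact ⟨x, hx, y, hy, hyT, (h x (hT hx) y hy).1 hadj⟩

lemma Hole.congr (h : ∀ x ∈ H, ∀ y ∈ H, G.Adj x y ↔ G'.Adj x y) (hH : Hole G H) : Hole G' H := by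
  refine ⟨hH.1, fun x hx => ?_⟩
  obtain ⟨y, hy, z, hz, hyz, h1, h2, h3, h4⟩ := hH.2 x hx
  exact ⟨y, hy, z, hz, hyz, (h x hx y hy).1 h1, (h x hx z hz).1 h2, fun h' => h3 ((h y hy z hz).2 h'),
    fun t ht h' => h4 t ht ((h x hx t ht).2 h')⟩

lemma Good.congr (h : ∀ x ∈ S, ∀ y ∈ S, G.Adj x y ↔ G'.Adj x y) (hS : Good G S) : Good G' S :=
  ⟨hS.1.congr h, fun H hH hh => hS.2 H hH
    (hh.congr fun x hx y hy => (h x (hH hx) y (hH hy)).symm)⟩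

/-- The recursion behind the upper bounds: its two terms are to be bounded by the two terms of
Pascal's rule. -/
lemma wcount_eq (G : SimpleGraph V) (A : Finset V) (k : ℕ) (v : V) : wcount G A k = wcount G (A.erase v) k + wcountAt G A k v := by
  classical
  unfold wcount wcountAt
  rw [← Finset.card_filter_add_card_filter_not (s := (A.powersetCard k).filter fun S => Good G S)
    (fun S => v ∉ S)]
  congr 2
  · ext S
    simp only [Finset.mem_filter, Finset.mem_powersetCard, Finset.subset_erase]
    tauto
  · ext S
    simp only [Finset.mem_filter, Finset.mem_powersetCard, not_not]
    tauto

lemma wcount_le_choose : wcount G A k ≤ A.card.choose k := by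
  classical
  unfold wcount
  exact (Finset.card_filter_le _ _).trans (Finset.card_powersetCard _ _).le

lemma ConnSet.mem_of_pendant (hS : ConnSet G S) (hSA : S ⊆ A) (hv : v ∈ S)
    (hn : nbrIn G A v = {u}) (h2 : 2 ≤ S.card) : u ∈ S := by
  obtain ⟨x, hx, y, hy, hyT, hadj⟩ := hS {v} (by simpa using hv) (by simp)
    (by rintro rfl; simp at h2)
  simp only [Finset.mem_singleton] at hx
  subst hx
  have : y ∈ nbrIn G A x := mem_nbrIn.2 ⟨hSA hy, hadj⟩
  rw [hn, Finset.mem_singleton] at this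
  exact this ▸ hy

lemma ne_of_nbrIn_singleton (hn : nbrIn G A v = {u}) : u ∈ A ∧ G.Adj v u :=
  mem_nbrIn.1 (hn ▸ Finset.mem_singleton_self u)

/-- Good sets containing a pendant vertex also contain its neighbour. -/
lemma wcountAt_pendant_le_card (hn : nbrIn G A v = {u}) (F : Finset (Finset V))
    (hF : ∀ R ⊆ (A.erase v).erase u, R.card = k → R ∉ F → ¬ Good G (insert v (insert u R))) :
    wcountAt G A (k + 2) v ≤ F.card := by
  classical
  obtain ⟨huA, hvu⟩ := ne_of_nbrIn_singleton hn
  unfold wcountAt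
  refine Finset.card_le_card_of_injOn (fun S => (S.erase v).erase u) ?_ ?_
  · intro S hS
    simp only [Finset.coe_filter, Finset.mem_powersetCard, Set.mem_ofPred_eq] at hS
    obtain ⟨⟨hSA, hc⟩, hvS, hg⟩ := hS
    have huS := hg.1.mem_of_pendant hSA hvS hn (by omega)
    have huS' : u ∈ S.erase v := Finset.mem_erase.2 ⟨hvu.ne', huS⟩
    by_contra hcon
    refine hF _ (Finset.erase_subset_erase _ (Finset.erase_subset_erase _ hSA)) ?_ hcon ?_
    · rw [Finset.card_erase_of_mem huS', Finset.card_erase_of_mem hvS]; omega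
    · rwa [Finset.insert_erase huS', Finset.insert_erase hvS]
  · intro S hS T hT h
    simp only [Finset.coe_filter, Finset.mem_powersetCard, Set.mem_ofPred_eq] at hS hT
    have huS := hS.2.2.1.mem_of_pendant hS.1.1 hS.2.1 hn (by omega)
    have huT := hT.2.2.1.mem_of_pendant hT.1.1 hT.2.1 hn (by omega)
    have huS' : u ∈ S.erase v := Finset.mem_erase.2 ⟨hvu.ne', huS⟩
    have huT' : u ∈ T.erase v := Finset.mem_erase.2 ⟨hvu.ne', huT⟩
    simp only at h
    rw [← Finset.insert_erase hS.2.1, ← Finset.insert_erase hT.2.1, ← Finset.insert_erase huS',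
      ← Finset.insert_erase huT', h]

lemma card_erase_erase_pendant (hv : v ∈ A) (hn : nbrIn G A v = {u}) :
    ((A.erase v).erase u).card = A.card - 2 := by
  obtain ⟨huA, hvu⟩ := ne_of_nbrIn_singleton hn
  rw [Finset.card_erase_of_mem (Finset.mem_erase.2 ⟨hvu.ne', huA⟩), Finset.card_erase_of_mem hv]
  omega

/-- Besides `v` and `u`, a good set through `v` has `k` vertices, chosen among `A.card - 2`. -/
lemma wcountAt_pendant (hv : v ∈ A) (hn : nbrIn G A v = {u}) :
    wcountAt G A (k + 2) v ≤ (A.card - 2).choose k := by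
  refine (wcountAt_pendant_le_card hn (((A.erase v).erase u).powersetCard k) ?_).trans ?_
  · intro R hR hk hR'
    exact absurd (Finset.mem_powersetCard.2 ⟨hR, hk⟩) hR'
  · rw [Finset.card_powersetCard, card_erase_erase_pendant hv hn]

/-- One bad choice `R` saves one set. This pays for the smaller graphs whose own bound fails by one.
-/
lemma wcountAt_pendant_lt (hv : v ∈ A) (hn : nbrIn G A v = {u}) {R : Finset V}
    (hR : R ⊆ (A.erase v).erase u) (hk : R.card = k) (hbad : ¬ Good G (insert v (insert u R))) :
    wcountAt G A (k + 2) v + 1 ≤ (A.card - 2).choose k := by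
  have hmem : R ∈ ((A.erase v).erase u).powersetCard k := Finset.mem_powersetCard.2 ⟨hR, hk⟩
  have h1 := wcountAt_pendant_le_card (k := k) hn
    ((((A.erase v).erase u).powersetCard k).erase R) (by
      intro R' hR' hk' hn'
      have : R' = R := by
        by_contra hne
        exact hn' (Finset.mem_erase.2 ⟨hne, Finset.mem_powersetCard.2 ⟨hR', hk'⟩⟩)
      rwa [this])
  have h2 := Finset.card_erase_add_one hmem
  rw [Finset.card_powersetCard, card_erase_erase_pendant hv hn] at h2
  omega

lemma ConnSet.erase_pendant (h : ConnSet G A) (hn : nbrIn G A v = {u}) :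
    ConnSet G (A.erase v) := by
  obtain ⟨huA, hvu⟩ := ne_of_nbrIn_singleton hn
  have key : ∀ x ∈ A, G.Adj x v → x = u := by
    intro x hx hxv
    have : x ∈ nbrIn G A v := mem_nbrIn.2 ⟨hx, hxv.symm⟩
    rwa [hn, Finset.mem_singleton] at this
  intro T hT hne hTA
  have hTA' : T ⊆ A := hT.trans (Finset.erase_subset _ _)
  have hvT : v ∉ T := fun h' => by simpa using hT h'
  -- `v` is put on the side of `u`, so that the crossing edge cannot be `vu`.
  by_cases huT : u ∈ T
  · by_cases hv : v ∈ A
    · obtain ⟨x, hx, y, hy, hyT, hadj⟩ := h (insert v T) (Finset.insert_subset hv hTA') (by simp) (by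
        intro h'; apply hTA; rw [← h', Finset.erase_insert hvT])
      rw [Finset.mem_insert, not_or] at hyT
      rw [Finset.mem_insert] at hx
      rcases hx with rfl | hx
      · exact absurd (key y hy hadj.symm ▸ huT) hyT.2
      · exact ⟨x, hx, y, Finset.mem_erase.2 ⟨hyT.1, hy⟩, hyT.2, hadj⟩
    · rw [Finset.erase_eq_of_notMem hv] at *
      exact h T hT hne hTA
  · obtain ⟨x, hx, y, hy, hyT, hadj⟩ := h T hTA' hne (by rintro rfl; exact huT huA)
    refine ⟨x, hx, y, Finset.mem_erase.2 ⟨?_, hy⟩, hyT, hadj⟩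
    rintro rfl
    exact huT (key x (hTA' hx) hadj ▸ hx)

lemma exists_nbrIn_eq_singleton (h : degIn G A v = 1) : ∃ u, nbrIn G A v = {u} :=
  Finset.card_eq_one.1 h

lemma exists_nbrIn_eq_pair (h : degIn G A v = 2) : ∃ u w, u ≠ w ∧ nbrIn G A v = {u, w} := by
  obtain ⟨u, w, h1, h2⟩ := Finset.card_eq_two.1 h
  exact ⟨u, w, h1, h2⟩

end basics

/-! ### Suppressing a vertex of degree two: it is deleted and its neighbours are joined. -/

section contraction
variable {V : Type*} [DecidableEq V] {G G' : SimpleGraph V} {A B S H : Finset V} {u v w x y : V}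
  {k : ℕ}

lemma sup_edge_adj_iff (h : u ≠ w) :
    (G ⊔ SimpleGraph.edge u w).Adj x y ↔ G.Adj x y ∨ (x = u ∧ y = w) ∨ (x = w ∧ y = u) := by
  rw [SimpleGraph.sup_adj, SimpleGraph.edge_adj]
  constructor
  · rintro (h | h)
    · exact Or.inl h
    · exact Or.inr h.1
  · rintro (h | h | h)
    · exact Or.inl h
    · exact Or.inr ⟨Or.inl h, by rw [h.1, h.2]; exact ‹u ≠ w›⟩
    · exact Or.inr ⟨Or.inr h, by rw [h.1, h.2]; exact (‹u ≠ w›).symm⟩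

/-- Suppressing a vertex of degree two preserves goodness. -/
lemma Good.suppress (hS : Good G S) (hSA : S ⊆ A) (hv : v ∈ S) (huw : u ≠ w)
    (hn : nbrIn G A v = {u, w}) : Good (G ⊔ SimpleGraph.edge u w) (S.erase v) := by
  have key : ∀ x ∈ A, G.Adj v x → x = u ∨ x = w := by
    intro x hx hxv
    have : x ∈ nbrIn G A v := mem_nbrIn.2 ⟨hx, hxv⟩
    simpa [hn] using this
  have hu : u ∈ nbrIn G A v := by rw [hn]; simp
  have hw : w ∈ nbrIn G A v := by rw [hn]; simp
  rw [mem_nbrIn] at hu hw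
  obtain ⟨huA, hvu⟩ := hu
  obtain ⟨hwA, hvw⟩ := hw
  constructor
  · intro T hT hne hTS
    by_contra! hcut
    have hTS' : T ⊆ S := hT.trans (Finset.erase_subset _ _)
    have hvT : v ∉ T := fun h' => by simpa using hT h'
    have hcutG : ∀ x ∈ T, ∀ y ∈ S, y ≠ v → y ∉ T → ¬ G.Adj x y := fun x hx y hy hyv hyT hadj =>
      hcut x hx y (Finset.mem_erase.2 ⟨hyv, hy⟩) hyT ((sup_edge_adj_iff huw).2 (Or.inl hadj))
    have h1 : u ∈ T → w ∈ S → w ∈ T := by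
      intro h1 h2
      by_contra h3
      exact hcut u h1 w (Finset.mem_erase.2 ⟨hvw.ne', h2⟩) h3
        ((sup_edge_adj_iff huw).2 (Or.inr (Or.inl ⟨rfl, rfl⟩)))
    have h2 : w ∈ T → u ∈ S → u ∈ T := by
      intro h1 h2
      by_contra h3
      exact hcut w h1 u (Finset.mem_erase.2 ⟨hvu.ne', h2⟩) h3
        ((sup_edge_adj_iff huw).2 (Or.inr (Or.inr ⟨rfl, rfl⟩)))
    -- The cut keeps `u` and `w` together as far as they lie in `S`; putting `v` on their side
    -- leaves it uncrossed in `G`.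
    by_cases hT' : u ∈ T ∨ w ∈ T
    · obtain ⟨x, hx, y, hy, hyT, hadj⟩ := hS.1 (insert v T) (Finset.insert_subset hv hTS')
        (by simp) (by intro h'; apply hTS; rw [← h', Finset.erase_insert hvT])
      rw [Finset.mem_insert, not_or] at hyT
      rw [Finset.mem_insert] at hx
      rcases hx with rfl | hx
      · rcases key y (hSA hy) hadj with rfl | rfl
        · exact hT'.elim hyT.2 fun h => hyT.2 (h2 h hy)
        · exact hT'.elim (fun h => hyT.2 (h1 h hy)) hyT.2
      · exact hcutG x hx y hy hyT.1 hyT.2 hadj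
    · push Not at hT'
      obtain ⟨x, hx, y, hy, hyT, hadj⟩ := hS.1 T hTS' hne (by rintro rfl; exact hvT hv)
      by_cases hyv : y = v
      · subst hyv
        rcases key x (hSA (hTS' hx)) hadj.symm with rfl | rfl
        · exact hT'.1 hx
        · exact hT'.2 hx
      · exact hcutG x hx y hy hyv hyT hadj
  · intro H hH hhole
    have hHS : H ⊆ S := hH.trans (Finset.erase_subset _ _)
    have hvH : v ∉ H := fun h' => by simpa using hH h'
    -- A hole that uses the new edge becomes a longer hole of `G` when this edge is subdivided by
    -- `v`; any other hole is already one of `G`.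
    by_cases hcase : u ∈ H ∧ w ∈ H ∧ ¬ G.Adj u w
    · obtain ⟨huH, hwH, hnadj⟩ := hcase
      have hnadj' : ¬ G.Adj w u := fun h => hnadj h.symm
      refine hS.2 (insert v H) (Finset.insert_subset hv hHS) ⟨by simp, ?_⟩
      have hvadj : ∀ t ∈ H, G.Adj v t → t = u ∨ t = w := fun t ht => key t (hSA (hHS ht))
      have hvadj' : ∀ t ∈ H, G.Adj t v → t = u ∨ t = w := fun t ht h => hvadj t ht h.symm
      -- At an end `a` of the new edge, `v` replaces the other end `b`, and the second hole
      -- neighbour `z` is kept.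
      have aux : ∀ a b, a ∈ H → b ∈ H → a ≠ b → (a = u ∧ b = w ∨ a = w ∧ b = u) →
          G.Adj v a → ∃ z ∈ H, v ≠ z ∧ G.Adj a z ∧ ¬ G.Adj v z ∧
            ∀ t ∈ insert v H, G.Adj a t → t = v ∨ t = z := by
        intro a b ha hb hab hor hva
        have hab' : (G ⊔ SimpleGraph.edge u w).Adj a b := by
          rw [sup_edge_adj_iff huw]; tauto
        have hnab : ¬ G.Adj a b := by
          rcases hor with ⟨rfl, rfl⟩ | ⟨rfl, rfl⟩ <;> assumption
        have hred : ∀ t, (G ⊔ SimpleGraph.edge u w).Adj a t → t ≠ b → G.Adj a t := by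
          intro t ht htb
          rw [sup_edge_adj_iff huw] at ht
          rcases ht with h | h | h
          · exact h
          · exfalso; rcases hor with ⟨rfl, rfl⟩ | ⟨rfl, rfl⟩
            · exact htb h.2
            · exact hab h.1
          · exfalso; rcases hor with ⟨rfl, rfl⟩ | ⟨rfl, rfl⟩
            · exact hab h.1
            · exact htb h.2
        have hfin : ∀ z ∈ H, z ≠ b → (G ⊔ SimpleGraph.edge u w).Adj a z →
            (∀ t ∈ H, (G ⊔ SimpleGraph.edge u w).Adj a t → t = b ∨ t = z) →
            ∃ z ∈ H, v ≠ z ∧ G.Adj a z ∧ ¬ G.Adj v z ∧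
            ∀ t ∈ insert v H, G.Adj a t → t = v ∨ t = z := by
          intro z hz hzb haz hall
          have haz' := hred z haz hzb
          refine ⟨z, hz, fun h => hvH (h ▸ hz), haz', ?_, ?_⟩
          · intro hvz
            have := hvadj z hz hvz
            have hza : z ≠ a := haz'.ne'
            rcases hor with ⟨rfl, rfl⟩ | ⟨rfl, rfl⟩ <;> tauto
          · intro t ht hat
            rw [Finset.mem_insert] at ht
            rcases ht with rfl | ht
            · exact Or.inl rfl
            · rcases hall t ht ((sup_edge_adj_iff huw).2 (Or.inl hat)) with rfl | h
              · exact absurd hat hnab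
              · exact Or.inr h
        obtain ⟨y, hy, z, hz, hyz, h1, h2, -, h4⟩ := hhole.2 a ha
        rcases h4 b hb hab' with rfl | rfl
        · exact hfin z hz hyz.symm h2 h4
        · exact hfin y hy hyz h1 fun t ht h => (h4 t ht h).symm
      intro x hx
      by_cases hxu : x = u
      · subst hxu
        obtain ⟨z, hz, h1, h2, h3, h4⟩ := aux x w huH hwH huw (Or.inl ⟨rfl, rfl⟩) hvu
        exact ⟨v, by simp, z, by simp [hz], h1, hvu.symm, h2, h3, h4⟩
      by_cases hxw : x = w
      · subst hxw
        obtain ⟨z, hz, h1, h2, h3, h4⟩ := aux x u hwH huH huw.symm (Or.inr ⟨rfl, rfl⟩) hvw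
        exact ⟨v, by simp, z, by simp [hz], h1, hvw.symm, h2, h3, h4⟩
      rw [Finset.mem_insert] at hx
      rcases hx with rfl | hx
      · refine ⟨u, by simp [huH], w, by simp [hwH], huw, hvu, hvw, hnadj, ?_⟩
        intro t ht hadj
        rw [Finset.mem_insert] at ht
        rcases ht with rfl | ht
        · exact absurd hadj (G.irrefl)
        · exact hvadj t ht hadj
      · have hxadj : ∀ t, (G ⊔ SimpleGraph.edge u w).Adj x t → G.Adj x t := by
          intro t ht
          rw [sup_edge_adj_iff huw] at ht
          tauto
        obtain ⟨y, hy, z, hz, hyz, h1, h2, h3, h4⟩ := hhole.2 x hx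
        refine ⟨y, by simp [hy], z, by simp [hz], hyz, hxadj _ h1, hxadj _ h2,
          fun h => h3 ((sup_edge_adj_iff huw).2 (Or.inl h)), ?_⟩
        intro t ht hadj
        rw [Finset.mem_insert] at ht
        rcases ht with rfl | ht
        · rcases hvadj' x hx hadj with h | h
          · exact absurd h hxu
          · exact absurd h hxw
        · exact h4 t ht ((sup_edge_adj_iff huw).2 (Or.inl hadj))
    · refine hS.2 H hHS (hhole.congr fun x hx y hy => ?_)
      rw [sup_edge_adj_iff huw]
      constructor
      · rintro (h | ⟨rfl, rfl⟩ | ⟨rfl, rfl⟩)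
        · exact h
        · by_contra h; exact hcase ⟨hx, hy, h⟩
        · by_contra h; exact hcase ⟨hy, hx, fun h' => h h'.symm⟩
      · exact Or.inl

/-- `u` and `w` may be adjacent; suppressing `v` then only deletes it. -/
lemma wcountAt_le_suppress (huw : u ≠ w) (hn : nbrIn G A v = {u, w}) :
    wcountAt G A (k + 1) v ≤ wcount (G ⊔ SimpleGraph.edge u w) (A.erase v) k := by
  classical
  unfold wcount wcountAt
  refine Finset.card_le_card_of_injOn (fun S => S.erase v) ?_ ?_
  · intro S hS
    simp only [Finset.coe_filter, Finset.mem_powersetCard, Set.mem_ofPred_eq] at hS ⊢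
    obtain ⟨⟨hSA, hc⟩, hvS, hg⟩ := hS
    exact ⟨⟨Finset.erase_subset_erase _ hSA, by rw [Finset.card_erase_of_mem hvS, hc]; rfl⟩,
      hg.suppress hSA hvS huw hn⟩
  · intro S hS T hT h
    simp only [Finset.coe_filter, Finset.mem_powersetCard, Set.mem_ofPred_eq] at hS hT
    simp only at h
    rw [← Finset.insert_erase hS.2.1, ← Finset.insert_erase hT.2.1, h]

/-- At `u` and `w` the new edge makes up for the lost edge to `v`. -/
lemma degIn_suppress (hvA : v ∈ A) (huw : u ≠ w) (hn : nbrIn G A v = {u, w}) (hadj : ¬ G.Adj u w)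
    (hx : x ∈ A.erase v) : degIn (G ⊔ SimpleGraph.edge u w) (A.erase v) x = degIn G A x := by
  have hu : u ∈ A ∧ G.Adj v u := mem_nbrIn.1 (by rw [hn]; simp)
  have hw : w ∈ A ∧ G.Adj v w := mem_nbrIn.1 (by rw [hn]; simp)
  have aux : ∀ a b, b ∈ A → G.Adj v a → G.Adj v b → a ≠ b → ¬ G.Adj a b →
      (a = u ∧ b = w ∨ a = w ∧ b = u) →
      degIn (G ⊔ SimpleGraph.edge u w) (A.erase v) a = degIn G A a := by
    intro a b hb hva hvb hab hnab hor
    have : nbrIn (G ⊔ SimpleGraph.edge u w) (A.erase v) a = insert b (nbrIn G (A.erase v) a) := by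
      ext t
      simp only [mem_nbrIn, Finset.mem_insert, sup_edge_adj_iff huw, Finset.mem_erase]
      have := hvb.ne'
      rcases hor with ⟨rfl, rfl⟩ | ⟨rfl, rfl⟩
      · constructor
        · tauto
        · rintro (rfl | h) <;> tauto
      · constructor
        · tauto
        · rintro (rfl | h) <;> tauto
    unfold degIn
    rw [this, Finset.card_insert_of_notMem (by simp [mem_nbrIn, hnab])]
    exact degIn_erase_of_adj hvA hva.symm
  by_cases hxu : x = u
  · subst hxu; exact aux x w hw.1 hu.2 hw.2 huw hadj (Or.inl ⟨rfl, rfl⟩)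
  by_cases hxw : x = w
  · subst hxw; exact aux x u hu.1 hw.2 hu.2 huw.symm (fun h => hadj h.symm) (Or.inr ⟨rfl, rfl⟩)
  · rw [Finset.mem_erase] at hx
    have hxv : ¬ G.Adj x v := by
      intro h
      have : x ∈ nbrIn G A v := mem_nbrIn.2 ⟨hx.2, h.symm⟩
      rw [hn] at this
      simp [hxu, hxw] at this
    rw [← degIn_erase_of_not_adj (A := A) hxv]
    unfold degIn
    congr 1
    ext t
    simp only [mem_nbrIn, sup_edge_adj_iff huw]
    tauto

lemma degSum_suppress (hvA : v ∈ A) (huw : u ≠ w) (hn : nbrIn G A v = {u, w})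
    (hadj : ¬ G.Adj u w) : degSum (G ⊔ SimpleGraph.edge u w) (A.erase v) + 2 = degSum G A := by
  unfold degSum
  rw [Finset.sum_congr rfl fun x hx => degIn_suppress hvA huw hn hadj hx,
    ← Finset.sum_erase_add A _ hvA]
  congr 1
  unfold degIn
  rw [hn, Finset.card_pair huw]

lemma ConnSet.suppress (h : ConnSet G A) (hvA : v ∈ A) (huw : u ≠ w)
    (hn : nbrIn G A v = {u, w}) : ConnSet (G ⊔ SimpleGraph.edge u w) (A.erase v) := by
  have hu : u ∈ A ∧ G.Adj v u := mem_nbrIn.1 (by rw [hn]; simp)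
  have hw : w ∈ A ∧ G.Adj v w := mem_nbrIn.1 (by rw [hn]; simp)
  have key : ∀ x ∈ A, G.Adj v x → x = u ∨ x = w := by
    intro x hx hxv
    have : x ∈ nbrIn G A v := mem_nbrIn.2 ⟨hx, hxv⟩
    simpa [hn] using this
  intro T hT hne hTA
  by_contra! hcut
  have hTA' : T ⊆ A := hT.trans (Finset.erase_subset _ _)
  have hvT : v ∉ T := fun h' => by simpa using hT h'
  have hcutG : ∀ x ∈ T, ∀ y ∈ A, y ≠ v → y ∉ T → ¬ G.Adj x y := fun x hx y hy hyv hyT hadj =>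
    hcut x hx y (Finset.mem_erase.2 ⟨hyv, hy⟩) hyT ((sup_edge_adj_iff huw).2 (Or.inl hadj))
  have h1 : u ∈ T → w ∈ T := by
    intro h1
    by_contra h3
    exact hcut u h1 w (Finset.mem_erase.2 ⟨hw.2.ne', hw.1⟩) h3
      ((sup_edge_adj_iff huw).2 (Or.inr (Or.inl ⟨rfl, rfl⟩)))
  have h2 : w ∈ T → u ∈ T := by
    intro h1
    by_contra h3
    exact hcut w h1 u (Finset.mem_erase.2 ⟨hu.2.ne', hu.1⟩) h3
      ((sup_edge_adj_iff huw).2 (Or.inr (Or.inr ⟨rfl, rfl⟩)))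
  by_cases hT' : u ∈ T
  · obtain ⟨x, hx, y, hy, hyT, hadj⟩ := h (insert v T) (Finset.insert_subset hvA hTA')
      (by simp) (by intro h'; apply hTA; rw [← h', Finset.erase_insert hvT])
    rw [Finset.mem_insert, not_or] at hyT
    rw [Finset.mem_insert] at hx
    rcases hx with rfl | hx
    · rcases key y hy hadj with rfl | rfl
      · exact hyT.2 hT'
      · exact hyT.2 (h1 hT')
    · exact hcutG x hx y hy hyT.1 hyT.2 hadj
  · obtain ⟨x, hx, y, hy, hyT, hadj⟩ := h T hTA' hne (by rintro rfl; exact hvT hvA)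
    by_cases hyv : y = v
    · subst hyv
      rcases key x (hTA' hx) hadj.symm with rfl | rfl
      · exact hT' hx
      · exact hT' (h2 hx)
    · exact hcutG x hx y hy hyv hyT hadj

/-- If deleting the degree-two vertex `v` disconnects the graph, then every good set of the
remaining graph stays good when the two neighbours of `v` are joined. -/
lemma wcount_erase_le_suppress (h : ConnSet G A) (hvA : v ∈ A) (huw : u ≠ w)
    (hn : nbrIn G A v = {u, w}) (hdis : ¬ ConnSet G (A.erase v)) :
    wcount G (A.erase v) k ≤ wcount (G ⊔ SimpleGraph.edge u w) (A.erase v) k := by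
  classical
  have hu : u ∈ A ∧ G.Adj v u := mem_nbrIn.1 (by rw [hn]; simp)
  have hw : w ∈ A ∧ G.Adj v w := mem_nbrIn.1 (by rw [hn]; simp)
  unfold ConnSet at hdis
  push Not at hdis
  obtain ⟨T, hT, hne, hTA, hcut⟩ := hdis
  have hTA' : T ⊆ A := hT.trans (Finset.erase_subset _ _)
  -- The suppressed graph is connected and `uw` is its only new edge, so a cut uncrossed in `G`
  -- separates `u` from `w`.
  have hsep : ¬ (u ∈ T ↔ w ∈ T) := by
    intro hiff
    obtain ⟨x, hx, y, hy, hyT, hadj⟩ := h.suppress hvA huw hn T hT hne hTA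
    rw [sup_edge_adj_iff huw] at hadj
    rcases hadj with hadj | ⟨rfl, rfl⟩ | ⟨rfl, rfl⟩
    · exact hcut x hx y hy hyT hadj
    · exact hyT (hiff.1 hx)
    · exact hyT (hiff.2 hx)
  unfold wcount
  refine Finset.card_le_card fun S hS => ?_
  rw [Finset.mem_filter, Finset.mem_powersetCard] at hS ⊢
  refine ⟨hS.1, hS.2.congr ?_⟩
  -- A connected set avoiding `v` lies on one side of the cut, so the new edge changes nothing
  -- inside it.
  have hnot : ¬ (u ∈ S ∧ w ∈ S) := by
    rintro ⟨huS, hwS⟩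
    have hne' : (S ∩ T).Nonempty := by
      by_contra hcon
      rw [Finset.not_nonempty_iff_eq_empty] at hcon
      have h1 : u ∉ T := fun h' => by
        have : u ∈ S ∩ T := Finset.mem_inter.2 ⟨huS, h'⟩
        simp [hcon] at this
      have h2 : w ∉ T := fun h' => by
        have : w ∈ S ∩ T := Finset.mem_inter.2 ⟨hwS, h'⟩
        simp [hcon] at this
      tauto
    obtain ⟨x, hx, y, hy, hyT, hadj⟩ := hS.2.1 (S ∩ T) Finset.inter_subset_left hne' (by
      intro h'
      rw [Finset.inter_eq_left] at h'
      exact hsep ⟨fun _ => h' hwS, fun _ => h' huS⟩)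
    rw [Finset.mem_inter] at hx hyT
    exact hcut x hx.2 y (hS.1.1 hy) (fun h' => hyT ⟨hy, h'⟩) hadj
  intro x hx y hy
  rw [sup_edge_adj_iff huw]
  constructor
  · exact Or.inl
  · rintro (h | ⟨rfl, rfl⟩ | ⟨rfl, rfl⟩)
    · exact h
    · exact absurd ⟨hx, hy⟩ hnot
    · exact absurd ⟨hy, hx⟩ hnot

end contraction

/-! ### Forests, cycles and unicyclic graphs. -/

section counting
variable {V : Type*} [DecidableEq V] {G G' : SimpleGraph V} {A B S H : Finset V} {u v w x y : V}
  {k : ℕ}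

lemma wcountAt_eq_zero (h : degIn G A v = 0) : wcountAt G A (k + 2) v = 0 := by
  classical
  unfold wcountAt
  refine Finset.card_eq_zero.2 (Finset.eq_empty_of_forall_notMem fun S hS => ?_)
  simp only [Finset.mem_filter, Finset.mem_powersetCard] at hS
  obtain ⟨hS, hv, hg⟩ := hS
  have := hg.1.degIn_pos hv (by omega)
  have := degIn_mono (G := G) (x := v) hS.1
  omega

/-- The hypothesis says that `A` induces a forest. It is hereditary, so leaves and isolated vertices
can be removed one at a time. -/
lemma wcount_forest (h : ∀ B ⊆ A, B.Nonempty → ∃ x ∈ B, degIn G B x ≤ 1) :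
    wcount G A (k + 2) ≤ (A.card - 1).choose (k + 1) := by
  induction hm : A.card generalizing A with
  | zero =>
    refine wcount_le_choose.trans ?_
    rw [hm]; simp
  | succ m ih =>
    obtain ⟨v, hv, hd⟩ := h A subset_rfl (Finset.card_pos.1 (by omega))
    have hc : (A.erase v).card = m := by rw [Finset.card_erase_of_mem hv, hm]; rfl
    have h1 := ih (fun B hB => h B (hB.trans (Finset.erase_subset _ _))) hc
    rw [wcount_eq G A (k + 2) v]
    have h2 : wcountAt G A (k + 2) v ≤ (m - 1).choose k := by
      rcases Nat.le_one_iff_eq_zero_or_eq_one.1 hd with h0 | h0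
      · rw [wcountAt_eq_zero h0]; exact Nat.zero_le _
      · obtain ⟨u, hu⟩ := exists_nbrIn_eq_singleton h0
        have := wcountAt_pendant (k := k) hv hu
        rwa [hm] at this
    -- For a single vertex `m - 1` truncates and Pascal's rule is not available, but both counts are
    -- zero.
    rcases m with _ | m
    · have h3 : wcount G (A.erase v) (k + 2) ≤ _ := wcount_le_choose
      rw [hc] at h3
      have h4 : wcountAt G A (k + 2) v = 0 := by
        apply wcountAt_eq_zero
        have h5 : nbrIn G A v ⊆ A.erase v := fun y hy => by
          rw [mem_nbrIn] at hy
          exact Finset.mem_erase.2 ⟨hy.2.ne', hy.1⟩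
        have h6 := Finset.card_le_card h5
        rw [hc] at h6
        exact Nat.le_zero.1 h6
      simp at h3
      simp [h3, h4]
    · simp only [Nat.add_sub_cancel] at *
      rw [Nat.choose_succ_succ']
      omega

/-- Connected triples have a centre. -/
lemma wcount_three_le : wcount G A 3 ≤ ∑ x ∈ A, (degIn G A x).choose 2 := by
  classical
  have : (A.powersetCard 3).filter (fun S => Good G S) ⊆
      A.biUnion fun x => ((nbrIn G A x).powersetCard 2).image (insert x) := by
    intro S hS
    rw [Finset.mem_filter, Finset.mem_powersetCard] at hS
    obtain ⟨⟨hSA, hc⟩, hg⟩ := hS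
    obtain ⟨a, ha⟩ : S.Nonempty := Finset.card_pos.1 (by omega)
    obtain ⟨b, hb, hab⟩ := degIn_pos_iff.1 (hg.1.degIn_pos ha (by omega))
    have hne : ({a, b} : Finset V) ≠ S := by
      rintro rfl
      rw [Finset.card_pair hab.ne] at hc
      omega
    -- The end `x` of `ab` to which the third vertex is attached is the centre.
    obtain ⟨x, hx, c, hcS, hcn, hxc⟩ := hg.1 {a, b} (by
      intro t; simp only [Finset.mem_insert, Finset.mem_singleton]; rintro (rfl | rfl) <;> assumption)
      (by simp) hne
    simp only [Finset.mem_insert, Finset.mem_singleton, not_or] at hcn hx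
    have h3 : ({a, b, c} : Finset V).card = 3 :=
      Finset.card_eq_three.2 ⟨a, b, c, hab.ne, Ne.symm hcn.1, Ne.symm hcn.2, rfl⟩
    have hS : S = {a, b, c} := (Finset.eq_of_subset_of_card_le (by
      intro t; simp only [Finset.mem_insert, Finset.mem_singleton]
      rintro (rfl | rfl | rfl) <;> assumption) (by omega)).symm
    rw [Finset.mem_biUnion]
    rcases hx with rfl | rfl
    · refine ⟨x, hSA ha, Finset.mem_image.2 ⟨{b, c}, ?_, hS.symm⟩⟩
      rw [Finset.mem_powersetCard, Finset.card_pair (Ne.symm hcn.2)]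
      refine ⟨?_, rfl⟩
      intro t; simp only [Finset.mem_insert, Finset.mem_singleton, mem_nbrIn]
      rintro (rfl | rfl)
      · exact ⟨hSA hb, hab⟩
      · exact ⟨hSA hcS, hxc⟩
    · refine ⟨x, hSA hb, Finset.mem_image.2 ⟨{a, c}, ?_, by rw [hS, Finset.insert_comm]⟩⟩
      rw [Finset.mem_powersetCard, Finset.card_pair (Ne.symm hcn.1)]
      refine ⟨?_, rfl⟩
      intro t; simp only [Finset.mem_insert, Finset.mem_singleton, mem_nbrIn]
      rintro (rfl | rfl)
      · exact ⟨hSA ha, hab.symm⟩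
      · exact ⟨hSA hcS, hxc⟩
  unfold wcount
  refine (Finset.card_le_card this).trans (Finset.card_biUnion_le.trans (Finset.sum_le_sum ?_))
  intro x _
  exact Finset.card_image_le.trans (Finset.card_powersetCard _ _).le

/-- The two neighbours of a vertex of degree two in a `2`-regular connected graph on at least four
vertices are not adjacent. -/
lemma not_adj_of_two_regular (h : ConnSet G A) (hreg : ∀ x ∈ A, degIn G A x = 2)
    (hA : 4 ≤ A.card) (hv : v ∈ A) (huw : u ≠ w) (hn : nbrIn G A v = {u, w}) : ¬ G.Adj u w := by
  intro hadj
  have hu : u ∈ A ∧ G.Adj v u := mem_nbrIn.1 (by rw [hn]; simp)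
  have hw : w ∈ A ∧ G.Adj v w := mem_nbrIn.1 (by rw [hn]; simp)
  have aux : ∀ a ∈ A, ∀ b ∈ A, ∀ c ∈ A, b ≠ c → G.Adj a b → G.Adj a c →
      nbrIn G A a = {b, c} := by
    intro a ha b hb c hc hbc hab hac
    refine (Finset.eq_of_subset_of_card_le ?_ ?_).symm
    · intro t; simp only [Finset.mem_insert, Finset.mem_singleton, mem_nbrIn]
      rintro (rfl | rfl)
      · exact ⟨hb, hab⟩
      · exact ⟨hc, hac⟩
    · rw [Finset.card_pair hbc]; exact (hreg a ha).le
  -- If `uw` were an edge, no edge would leave the triangle `v, u, w`, although there are further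
  -- vertices.
  obtain ⟨x, hx, y, hy, hyT, hxy⟩ := h {v, u, w} (by
    intro t; simp only [Finset.mem_insert, Finset.mem_singleton]
    rintro (rfl | rfl | rfl)
    · exact hv
    · exact hu.1
    · exact hw.1) (by simp) (by
    rintro rfl
    have := Finset.card_le_three (a := v) (b := u) (c := w)
    omega)
  have hy' : y ∈ nbrIn G A x := mem_nbrIn.2 ⟨hy, hxy⟩
  simp only [Finset.mem_insert, Finset.mem_singleton, not_or] at hx hyT
  rcases hx with rfl | rfl | rfl
  · rw [hn] at hy'; simp only [Finset.mem_insert, Finset.mem_singleton] at hy'; tauto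
  · rw [aux x hu.1 v hv w hw.1 hw.2.ne hu.2.symm hadj] at hy'
    simp only [Finset.mem_insert, Finset.mem_singleton] at hy'; tauto
  · rw [aux x hw.1 v hv u hu.1 hu.2.ne hw.2.symm hadj.symm] at hy'
    simp only [Finset.mem_insert, Finset.mem_singleton] at hy'; tauto

/-- The bound for cycles. -/
lemma wcount_cycle (h : ConnSet G A) (hreg : ∀ x ∈ A, degIn G A x = 2)
    (hk : k + 5 ≤ A.card) : wcount G A (k + 3) ≤ (A.card - 1).choose (k + 2) := by
  -- `hk` excludes sets of size `A.card - 1`: a cycle of order `n` contains `n` paths of order `n -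
  -- 1`, one more than the bound.
  induction k generalizing G A with
  | zero =>
    refine wcount_three_le.trans ?_
    rw [Finset.sum_congr rfl fun x hx => by rw [hreg x hx]]
    simp only [Nat.choose_self, Finset.sum_const, smul_eq_mul, mul_one, zero_add]
    obtain ⟨n, hn⟩ := Nat.exists_eq_add_of_le hk
    rw [hn, show 0 + 5 + n - 1 = n + 4 by omega, Nat.choose_two_right, Nat.le_div_iff_mul_le two_pos]
    simp only [Nat.add_succ_sub_one]
    nlinarith
  | succ k ih =>
    obtain ⟨v, hv⟩ : A.Nonempty := Finset.card_pos.1 (by omega)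
    obtain ⟨u, w, huw, hn⟩ := exists_nbrIn_eq_pair (hreg v hv)
    have hnadj := not_adj_of_two_regular h hreg (by omega) hv huw hn
    have hc : (A.erase v).card = A.card - 1 := Finset.card_erase_of_mem hv
    have h1 := ih (h.suppress hv huw hn)
      (fun x hx => by rw [degIn_suppress hv huw hn hnadj hx, hreg x (Finset.mem_of_mem_erase hx)])
      (by omega)
    have h2 := wcountAt_le_suppress (k := k + 3) huw hn
    -- Deleting `v` leaves a forest: by connectivity every nonempty proper part has a vertex with a
    -- neighbour outside, hence of degree at most one.
    have h3 : wcount G (A.erase v) (k + 2 + 2) ≤ ((A.erase v).card - 1).choose (k + 2 + 1) := by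
      refine wcount_forest fun B hB hne => ?_
      have hBA : B ⊆ A := hB.trans (Finset.erase_subset _ _)
      obtain ⟨x, hx, y, hy, hyB, hadj⟩ := h B hBA hne (by
        rintro rfl; simpa using hB hv)
      refine ⟨x, hx, ?_⟩
      have h5 := degIn_erase_of_adj hy hadj
      rw [hreg x (hBA hx)] at h5
      have h6 : degIn G B x ≤ degIn G (A.erase y) x :=
        degIn_mono fun t ht => Finset.mem_erase.2 ⟨fun h' => hyB (h' ▸ ht), hBA ht⟩
      omega
    rw [hc] at h1 h3
    rw [wcount_eq G A (k + 1 + 3) v]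
    obtain ⟨n, hn⟩ := Nat.exists_eq_add_of_le hk
    rw [show A.card - 1 = n + k + 4 + 1 by omega] at h1 h3 ⊢
    rw [show k + 1 + 2 = (k + 2) + 1 by omega, Nat.choose_succ_succ]
    simp only [Nat.add_sub_cancel, Nat.succ_eq_add_one] at *
    have h4 : wcount G (A.erase v) (k + 1 + 3) = wcount G (A.erase v) (k + 2 + 2) := by ring_nf
    have h5 : wcountAt G A (k + 1 + 3) v = wcountAt G A (k + 3 + 1) v := by ring_nf
    omega

lemma wcount_le_of_card_le (hk : A.card ≤ k + 1) (hA : A.Nonempty) :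
    wcount G A (k + 1) ≤ (A.card - 1).choose k := by
  refine wcount_le_choose.trans ?_
  have := Finset.card_pos.2 hA
  rcases hk.eq_or_lt with h | h
  · rw [h]; simp
  · rw [Nat.choose_eq_zero_of_lt h]; exact Nat.zero_le _

/-- A set with an uncrossed cut is not good. -/
lemma not_good_of_cut {T : Finset V} (hT : T ⊆ S) (hne : T.Nonempty) (hTS : T ≠ S)
    (hcut : ∀ x ∈ T, ∀ y ∈ S, y ∉ T → ¬ G.Adj x y) : ¬ Good G S := by
  intro hg
  obtain ⟨x, hx, y, hy, hyT, hadj⟩ := hg.1 T hT hne hTS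
  exact hcut x hx y hy hyT hadj

/-- The bound for unicyclic graphs other than cycles. -/
lemma wcount_unicyclic (h : ConnSet G A) (hsum : degSum G A = 2 * A.card)
    (hirr : ∃ x ∈ A, degIn G A x ≠ 2) :
    wcount G A (k + 3) ≤ (A.card - 1).choose (k + 2) := by
  induction hm : A.card generalizing A with
  | zero =>
    obtain ⟨x, hx, -⟩ := hirr
    exact absurd (Finset.card_pos.2 ⟨x, hx⟩) (by omega)
  | succ m ih =>
    have hAne : A.Nonempty := by obtain ⟨x, hx, -⟩ := hirr; exact ⟨x, hx⟩
    by_cases hk : m ≤ k + 2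
    · have := wcount_le_of_card_le (G := G) (k := k + 2) (A := A) (by omega) hAne
      rwa [hm] at this
    push Not at hk
    obtain ⟨v, hv, hd⟩ : ∃ v ∈ A, degIn G A v < 2 := by
      by_contra! hcon
      obtain ⟨x, hx, hne⟩ := hirr
      have : ∑ x ∈ A, 2 < ∑ x ∈ A, degIn G A x :=
        Finset.sum_lt_sum hcon ⟨x, hx, lt_of_le_of_ne (hcon x hx) (Ne.symm hne)⟩
      unfold degSum at hsum
      rw [hsum, Finset.sum_const, smul_eq_mul] at this
      omega
    have hd1 : degIn G A v = 1 := by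
      have := h.degIn_pos hv (by omega)
      omega
    obtain ⟨u, hu⟩ := exists_nbrIn_eq_singleton hd1
    obtain ⟨huA, hvu⟩ := ne_of_nbrIn_singleton hu
    have hc : (A.erase v).card = m := by rw [Finset.card_erase_of_mem hv, hm]; rfl
    have hconn := h.erase_pendant hu
    have hs := degSum_erase (G := G) hv
    have hpend : wcountAt G A (k + 3) v ≤ _ := wcountAt_pendant (k := k + 1) hv hu
    rw [hm] at hpend
    rw [wcount_eq G A (k + 3) v]
    obtain ⟨l, rfl⟩ : ∃ l, m = l + 1 := ⟨m - 1, by omega⟩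
    have hp2 : (l + 1 + 1 - 2) = l := by omega
    rw [hp2] at hpend
    rw [Nat.add_sub_cancel]
    have hpas : (l + 1).choose (k + 2) = l.choose (k + 1) + l.choose (k + 2) :=
      Nat.choose_succ_succ' _ _
    by_cases hreg : ∃ x ∈ A.erase v, degIn G (A.erase v) x ≠ 2
    · have h1 := ih hconn (by omega) hreg hc
      rw [Nat.add_sub_cancel] at h1
      omega
    -- Now `A` is a cycle with the pendant vertex `v` attached at `u`.
    push Not at hreg
    by_cases h5 : k + 5 ≤ l + 1
    · have h1 := wcount_cycle (k := k) hconn hreg (by omega)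
      rw [hc, Nat.add_sub_cancel] at h1
      omega
    by_cases h6 : l + 1 = k + 3
    · have h1 : wcount G (A.erase v) (k + 3) ≤ _ := wcount_le_of_card_le (k := k + 2) (by omega)
        ⟨u, Finset.mem_erase.2 ⟨hvu.ne', huA⟩⟩
      rw [hc, Nat.add_sub_cancel] at h1
      omega
    -- The cycle has order `k + 4` and as many subsets of size `k + 3`, one too many. In return, `v`
    -- and `u` together with the non-neighbours of `u` on the cycle form a disconnected set of this
    -- size.
    obtain rfl : l = k + 3 := by omega
    have huA' : u ∈ A.erase v := Finset.mem_erase.2 ⟨hvu.ne', huA⟩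
    obtain ⟨x, y, hxy, hxyn⟩ := exists_nbrIn_eq_pair (hreg u huA')
    have hx : x ∈ A.erase v ∧ G.Adj u x := mem_nbrIn.1 (by rw [hxyn]; simp)
    have hy : y ∈ A.erase v ∧ G.Adj u y := mem_nbrIn.1 (by rw [hxyn]; simp)
    have hsub : nbrIn G (A.erase v) u ⊆ (A.erase v).erase u := fun t ht => by
      rw [mem_nbrIn] at ht; exact Finset.mem_erase.2 ⟨ht.2.ne', ht.1⟩
    have hcR : (((A.erase v).erase u) \ nbrIn G (A.erase v) u).card = k + 1 := by
      rw [Finset.card_sdiff_of_subset hsub, Finset.card_erase_of_mem huA', hc]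
      have : (nbrIn G (A.erase v) u).card = 2 := hreg u huA'
      omega
    have hbad : wcountAt G A (k + 3) v + 1 ≤ _ := wcountAt_pendant_lt (k := k + 1) hv hu
      (R := ((A.erase v).erase u) \ nbrIn G (A.erase v) u) Finset.sdiff_subset hcR (by
        refine not_good_of_cut (T := {v, u}) ?_ (by simp) ?_ ?_
        · intro t; simp only [Finset.mem_insert, Finset.mem_singleton]; tauto
        · intro h'
          obtain ⟨r, hr⟩ := Finset.card_pos.1 (show 0 < _ by rw [hcR]; omega)
          have hr' := hr
          rw [Finset.mem_sdiff, Finset.mem_erase, Finset.mem_erase] at hr'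
          have : r ∈ ({v, u} : Finset V) := by rw [h']; simp only [Finset.mem_insert]; tauto
          simp only [Finset.mem_insert, Finset.mem_singleton] at this
          tauto
        · intro a ha b hb hbT hadj
          simp only [Finset.mem_insert, Finset.mem_singleton, not_or] at ha hbT hb
          rcases hb with hb | hb | hb
          · exact hbT.1 hb
          · exact hbT.2 hb
          rw [Finset.mem_sdiff] at hb
          rcases ha with rfl | rfl
          · have : b ∈ nbrIn G A a := mem_nbrIn.2
              ⟨Finset.mem_of_mem_erase (Finset.mem_of_mem_erase hb.1), hadj⟩
            rw [hu, Finset.mem_singleton] at this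
            exact hbT.2 this
          · exact hb.2 (mem_nbrIn.2 ⟨Finset.mem_of_mem_erase hb.1, hadj⟩))
    have h1 : wcount G (A.erase v) (k + 3) ≤ _ := wcount_le_choose
    rw [hc] at h1
    rw [hm, hp2] at hbad
    have e2 : (k + 3 + 1).choose (k + 3) = k + 4 := Nat.choose_succ_self_right (k + 3)
    have e3 : (k + 3).choose (k + 2) = k + 3 := Nat.choose_succ_self_right (k + 2)
    omega

end counting

/-! Graphs and vertex sets on `{0, …, n - 1}` with `n ≤ 8` as bit masks. The functions are written
with recursors, so that the kernel evaluates them quickly. -/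

/-- `f m`, where the kernel evaluates `m` first. -/
def forced {α : Type} (m : ℕ) (f : ℕ → α) : α := Nat.rec (f 0) (fun r _ => f (Nat.succ r)) m

def bitOf (m i : ℕ) : Bool := Nat.beq (Nat.mod (Nat.shiftRight m i) 2) 1

/-- The neighbourhood of `i` in the graph with adjacency matrix `R`. -/
def rowOf (R i : ℕ) : ℕ := Nat.mod (Nat.shiftRight R (Nat.mul 8 i)) 256

/-- Add to `T` the neighbours in `S` of its elements. -/
def spread (R S n : ℕ) : ℕ → ℕ :=
  Nat.rec (fun T => T) (fun i ih T =>
    cond (bitOf T i) (forced (Nat.lor T (Nat.land (rowOf R i) S)) ih) (ih T)) n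

def forallBit (T : ℕ) (q : ℕ → Bool) (n : ℕ) : Bool :=
  Nat.rec true (fun i ih => cond (bitOf T i) (cond (q i) ih false) ih) n

/-- `T` is a union of components of the graph induced by `S`, and not all of it. -/
def isCut (n R S T : ℕ) : Bool :=
  cond (Nat.beq T 0) false (cond (Nat.beq T S) false (cond (Nat.beq (Nat.land T S) T)
    (forallBit T (fun i => forced (Nat.land (rowOf R i) S) fun N => Nat.beq (Nat.land N T) N) n)
    false))

/-- Remove vertices of degree at most one from `H`. -/
def prune (R n : ℕ) : ℕ → ℕ :=
  Nat.rec (fun H => H) (fun i ih H =>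
    cond (cond (bitOf H i) (forced (Nat.land (rowOf R i) H) fun N =>
        -- `N` and `N - 1` have no common bit exactly when `N` has at most one bit.
        Nat.beq (Nat.land N (Nat.sub N 1)) 0) false)
      (forced (Nat.sub H (Nat.pow 2 i)) ih) (ih H)) n

/-- `N` consists of two nonadjacent vertices. -/
def isNonedge (R N : ℕ) : Bool :=
  forced (Nat.log2 N) fun z => forced (Nat.log2 (Nat.sub N (Nat.pow 2 z))) fun y =>
  cond (Nat.ble (Nat.succ y) z) (cond (Nat.beq N (Nat.add (Nat.pow 2 y) (Nat.pow 2 z)))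
  (cond (bitOf (rowOf R z) y) false true) false) false

def isHole (n R S H : ℕ) : Bool :=
  cond (Nat.beq H 0) false (cond (Nat.beq (Nat.land H S) H)
    (forallBit H (fun i => forced (Nat.land (rowOf R i) H) (isNonedge R)) n) false)

/-- A sufficient condition for `S` not to be good. -/
def isBad (n R S : ℕ) : Bool :=
  -- The search starts at the lowest element of `S` and makes two sweeps. If they fall short of a
  -- component, `isCut` rejects the result and `S` is at worst counted as good.
  cond (forced (spread R S n (spread R S n (Nat.sub S (Nat.land S (Nat.sub S 1))))) (isCut n R S))
    true (forced (prune R n S) (isHole n R S))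

/-- The number of `k`-subsets `S` of `{0, …, d - 1}` such that `p` holds for `acc` plus the mask
of `S`. -/
def countSets (p : ℕ → Bool) (d : ℕ) : ℕ → ℕ → ℕ :=
  Nat.rec (fun k acc => Nat.rec (cond (p acc) 1 0) (fun _ _ => 0) k)
    (fun d ih k acc => Nat.rec (cond (p acc) 1 0)
      (fun k _ => Nat.add (ih (Nat.succ k) acc) (ih k (Nat.add acc (Nat.pow 2 d)))) k) d

/-- An upper bound for the number of good `k`-sets. -/
def goodCount (n R k : ℕ) : ℕ :=
  countSets (fun S => forced S fun S => cond (isBad n R S) false true) n k 0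

/-- Both entries of the symmetric matrix, whose rows take eight bits each. -/
def edgeCode (e : ℕ × ℕ) : ℕ := 2 ^ (8 * e.1 + e.2) + 2 ^ (8 * e.2 + e.1)

/-- `p` holds for all graphs that arise from `R` by adding `c` of the edges in `l`. -/
def allGraphs (p : ℕ → Bool) (l : List (ℕ × ℕ)) : ℕ → ℕ → Bool :=
  List.rec (fun c R => Nat.rec (forced R p) (fun _ _ => true) c)
    (fun e _ ih c R => Nat.rec (forced R p) (fun c _ =>
      cond (ih (Nat.succ c) R) (ih c (Nat.add R (edgeCode e))) false) c) l

def pairsBelow : ℕ → List (ℕ × ℕ)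
  | 0 => []
  | n + 1 => pairsBelow n ++ (List.range n).map fun i => (i, n)

/-- Pairs have their smaller end first, so these avoid the first `s` vertices. -/
def freePairs (s n : ℕ) : List (ℕ × ℕ) := (pairsBelow n).filter fun e => s ≤ e.1

/-- Lets the checks skip enumerated graphs with a vertex of degree at most one, whose row is zero or
a power of two. -/
def minDegTwo (n R : ℕ) : Bool :=
  Nat.rec true (fun i ih => cond (forced (rowOf R i) fun N =>
    cond (Nat.beq N 0) true (Nat.beq N (Nat.pow 2 (Nat.log2 N)))) false ih) n

def existsBelow (q : ℕ → Bool) : ℕ → Bool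
  | 0 => false
  | i + 1 => q i || existsBelow q i

/-! ### Soundness of the bit mask computation. -/

section sound
variable {K : SimpleGraph ℕ} {n k : ℕ} {S : Finset ℕ}

lemma forced_eq {α : Type} (m : ℕ) (f : ℕ → α) : forced m f = f m := by cases m <;> rfl

lemma bitOf_eq (m i : ℕ) : bitOf m i = m.testBit i := by
  rw [Bool.eq_iff_iff, Nat.testBit_eq_decide_div_mod_eq, decide_eq_true_iff, bitOf, Nat.beq_eq,
    ← Nat.shiftRight_eq_div_pow]
  rfl

/-- The bit mask of a set. -/
def maskOf (S : Finset ℕ) : ℕ := ∑ i ∈ S, 2 ^ i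

lemma testBit_maskOf (S : Finset ℕ) (i : ℕ) : (maskOf S).testBit i = true ↔ i ∈ S := by
  rw [← Nat.mem_bitIndices, ← List.mem_toFinset, maskOf, Finset.toFinset_bitIndices_sum_two_pow]

open Classical in
/-- The adjacency matrix of `K` on `{0, …, n - 1}` as a bit mask. -/
noncomputable def codeOf (K : SimpleGraph ℕ) (n : ℕ) : ℕ :=
  ∑ i ∈ Finset.range n, ∑ j ∈ Finset.range n, if K.Adj i j then 2 ^ (8 * i + j) else 0

/-- For `i, j < 8` the number `8 * i + j` determines both, so distinct entries give distinct powers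
of two. -/
lemma codeOf_eq_maskOf (hn : n ≤ 8) : ∃ F : Finset ℕ, codeOf K n = maskOf F ∧
    ∀ i < n, ∀ j < n, 8 * i + j ∈ F ↔ K.Adj i j := by
  classical
  refine ⟨((Finset.range n ×ˢ Finset.range n).filter fun e => K.Adj e.1 e.2).image
    fun e => 8 * e.1 + e.2, ?_, ?_⟩
  · rw [maskOf, Finset.sum_image, Finset.sum_filter, Finset.sum_product]
    · rfl
    · intro a ha b hb h
      simp only [Finset.coe_filter, Finset.mem_product, Finset.mem_range, Set.mem_ofPred_eq] at ha hb
      simp only at h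
      exact Prod.ext (by omega) (by omega)
  · intro i hi j hj
    simp only [Finset.mem_image, Finset.mem_filter, Finset.mem_product, Finset.mem_range,
      Prod.exists]
    constructor
    · rintro ⟨a, b, ⟨⟨ha, hb⟩, hadj⟩, h⟩
      obtain rfl : a = i := by omega
      obtain rfl : b = j := by omega
      exact hadj
    · intro h
      exact ⟨i, j, ⟨⟨hi, hj⟩, h⟩, rfl⟩

lemma testBit_rowOf (hn : n ≤ 8) {i j : ℕ} (hi : i < n) (hj : j < n) :
    (rowOf (codeOf K n) i).testBit j = true ↔ K.Adj i j := by
  obtain ⟨F, hF, hadj⟩ := codeOf_eq_maskOf (K := K) hn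
  have : rowOf (codeOf K n) i = (codeOf K n >>> (8 * i)) % 2 ^ 8 := rfl
  rw [this, Nat.testBit_mod_two_pow, Nat.testBit_shiftRight, ← hadj i hi j hj, hF,
    Bool.and_eq_true, testBit_maskOf]
  simp only [decide_eq_true_eq, and_iff_right_iff_imp]
  omega

lemma forallBit_iff (T : ℕ) (q : ℕ → Bool) (n : ℕ) :
    forallBit T q n = true ↔ ∀ i < n, T.testBit i = true → q i = true := by
  induction n with
  | zero => simp [forallBit]
  | succ n ih =>
    have : forallBit T q (n + 1) =
      cond (bitOf T n) (cond (q n) (forallBit T q n) false) (forallBit T q n) := rfl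
    rw [this, bitOf_eq]
    constructor
    · intro h i hi hT
      rcases Nat.lt_succ_iff_lt_or_eq.1 hi with hi | rfl
      · refine ih.1 ?_ i hi hT
        cases h1 : T.testBit n <;> cases h2 : q n <;> simp_all
      · rw [hT] at h
        cases h2 : q i <;> simp_all
    · intro h
      have h1 := ih.2 fun i hi => h i (by omega)
      rw [h1]
      cases h2 : T.testBit n
      · rfl
      · rw [h n (by omega) h2]; rfl

lemma existsBelow_iff (q : ℕ → Bool) (n : ℕ) :
    existsBelow q n = true ↔ ∃ i < n, q i = true := by
  induction n with
  | zero => simp [existsBelow]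
  | succ n ih =>
    rw [existsBelow, Bool.or_eq_true, ih]
    constructor
    · rintro (h | ⟨i, hi, h⟩)
      · exact ⟨n, by omega, h⟩
      · exact ⟨i, by omega, h⟩
    · rintro ⟨i, hi, h⟩
      rcases Nat.lt_succ_iff_lt_or_eq.1 hi with hi | rfl
      · exact Or.inr ⟨i, hi, h⟩
      · exact Or.inl h

lemma cond_false_right {a b : Bool} : cond a b false = true ↔ a = true ∧ b = true := by
  cases a <;> simp

lemma cond_false_left {a b : Bool} : cond a false b = true ↔ a = false ∧ b = true := by
  cases a <;> simp

lemma natBeq_eq_false {a b : ℕ} : Nat.beq a b = false ↔ a ≠ b := by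
  rw [← Bool.not_eq_true, Nat.beq_eq]

/-- A mask contained in the mask of `S` is the mask of a subset of `S`. -/
lemma exists_maskOf_of_land_eq {T : ℕ} (h : Nat.land T (maskOf S) = T) :
    ∃ T' ⊆ S, T = maskOf T' := by
  refine ⟨T.bitIndices.toFinset, ?_, (Finset.sum_toFinset_bitIndices_two_pow T).symm⟩
  intro i hi
  rw [List.mem_toFinset, Nat.mem_bitIndices] at hi
  rw [← testBit_maskOf]
  have h2 : (T &&& maskOf S).testBit i = T.testBit i := congrArg (fun m => Nat.testBit m i) h
  rw [Nat.testBit_and, hi] at h2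
  simpa using h2

lemma testBit_row_land (hn : n ≤ 8) {i j : ℕ} (hi : i < n) (hS : S ⊆ Finset.range n) :
    (Nat.land (rowOf (codeOf K n) i) (maskOf S)).testBit j = true ↔ j ∈ S ∧ K.Adj i j := by
  have : (rowOf (codeOf K n) i &&& maskOf S).testBit j = true ↔ j ∈ S ∧ K.Adj i j := by
    rw [Nat.testBit_and, Bool.and_eq_true, testBit_maskOf]
    constructor
    · rintro ⟨h1, h2⟩
      exact ⟨h2, (testBit_rowOf hn hi (Finset.mem_range.1 (hS h2))).1 h1⟩
    · rintro ⟨h1, h2⟩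
      exact ⟨(testBit_rowOf hn hi (Finset.mem_range.1 (hS h1))).2 h2, h1⟩
  exact this

lemma isCut_sound (hn : n ≤ 8) (hS : S ⊆ Finset.range n) {T : ℕ}
    (h : isCut n (codeOf K n) (maskOf S) T = true) : ¬ Good K S := by
  unfold isCut at h
  rw [cond_false_left, cond_false_left, cond_false_right, natBeq_eq_false, natBeq_eq_false,
    Nat.beq_eq, forallBit_iff] at h
  obtain ⟨h0, hTS, hsub, hclosed⟩ := h
  obtain ⟨T, hT, rfl⟩ := exists_maskOf_of_land_eq hsub
  refine not_good_of_cut hT ?_ ?_ ?_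
  · rw [Finset.nonempty_iff_ne_empty]
    rintro rfl
    exact h0 (by simp [maskOf])
  · rintro rfl
    exact hTS rfl
  · intro x hx y hy hyT hadj
    have hxn : x < n := Finset.mem_range.1 (hS (hT hx))
    have h1 := hclosed x hxn ((testBit_maskOf _ _).2 hx)
    rw [forced_eq, Nat.beq_eq] at h1
    have h2 := (testBit_row_land hn hxn hS).2 ⟨hy, hadj⟩
    rw [← h1] at h2
    have h3 : (Nat.land (rowOf (codeOf K n) x) (maskOf S) &&& maskOf T).testBit y = true := h2
    rw [Nat.testBit_and, Bool.and_eq_true, testBit_maskOf] at h3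
    exact hyT h3.2

lemma isHole_sound (hn : n ≤ 8) (hS : S ⊆ Finset.range n) {H : ℕ}
    (h : isHole n (codeOf K n) (maskOf S) H = true) : ¬ Good K S := by
  unfold isHole at h
  rw [cond_false_left, cond_false_right, natBeq_eq_false, Nat.beq_eq, forallBit_iff] at h
  obtain ⟨h0, hsub, hall⟩ := h
  obtain ⟨H, hH, rfl⟩ := exists_maskOf_of_land_eq hsub
  intro hg
  refine hg.2 H hH ⟨?_, ?_⟩
  · rw [Finset.nonempty_iff_ne_empty]
    rintro rfl
    exact h0 (by simp [maskOf])
  · intro x hx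
    have hxn : x < n := Finset.mem_range.1 (hS (hH hx))
    have h1 := hall x hxn ((testBit_maskOf _ _).2 hx)
    rw [forced_eq] at h1
    have hrow := fun j => testBit_row_land (K := K) (j := j) hn hxn (hH.trans hS)
    set N := Nat.land (rowOf (codeOf K n) x) (maskOf H) with hN
    unfold isNonedge at h1
    rw [forced_eq, forced_eq, cond_false_right, cond_false_right, cond_false_left,
      Nat.beq_eq, bitOf_eq] at h1
    obtain ⟨hlt, heq, hnon, -⟩ := h1
    set z := Nat.log2 N
    set y := Nat.log2 (Nat.sub N (Nat.pow 2 z))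
    have hyz : y < z := Nat.le_of_ble_eq_true hlt
    have hmask : N = maskOf {y, z} := by
      rw [maskOf, Finset.sum_pair hyz.ne]
      exact heq
    have hmem : ∀ j, j ∈ ({y, z} : Finset ℕ) ↔ j ∈ H ∧ K.Adj x j := by
      intro j
      rw [← hrow j, hmask, testBit_maskOf]
    have hy := (hmem y).1 (by simp)
    have hz := (hmem z).1 (by simp)
    refine ⟨y, hy.1, z, hz.1, hyz.ne, hy.2, hz.2, ?_, ?_⟩
    · intro hadj
      rw [(testBit_rowOf hn (Finset.mem_range.1 (hS (hH hz.1)))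
        (Finset.mem_range.1 (hS (hH hy.1)))).2 hadj.symm] at hnon
      cases hnon
    · intro t ht hadj
      simpa using (hmem t).2 ⟨ht, hadj⟩

/-- Whatever `spread` and `prune` return is verified by `isCut` and `isHole`, so nothing has to be
proved about them. -/
lemma isBad_sound (hn : n ≤ 8) (hS : S ⊆ Finset.range n)
    (h : isBad n (codeOf K n) (maskOf S) = true) : ¬ Good K S := by
  unfold isBad at h
  rw [forced_eq, forced_eq] at h
  cases hc : isCut n (codeOf K n) (maskOf S) (spread (codeOf K n) (maskOf S) n
    (spread (codeOf K n) (maskOf S) n (Nat.sub (maskOf S) (Nat.land (maskOf S)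
      (Nat.sub (maskOf S) 1)))))
  · rw [hc] at h
    exact isHole_sound hn hS h
  · exact isCut_sound hn hS hc

/-- The recursion splits on whether the largest available element is taken. -/
lemma card_filter_le_countSets (p : ℕ → Bool) (d k acc : ℕ) :
    (((Finset.range d).powersetCard k).filter fun S => p (acc + maskOf S) = true).card ≤
      countSets p d k acc := by
  have hzero : ∀ s : Finset ℕ, ((s.powersetCard 0).filter fun S => p (acc + maskOf S) = true).card
      ≤ cond (p acc) 1 0 := by
    intro s
    rw [Finset.powersetCard_zero, Finset.filter_singleton]
    cases h : p acc <;> simp [maskOf, h]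
  induction d generalizing k acc with
  | zero =>
    rcases k with _ | k
    · exact hzero _
    · rw [Finset.range_zero, Finset.powersetCard_eq_empty.2 (by simp)]
      simp
  | succ d ih =>
    rcases k with _ | k
    · exact hzero _
    · have hstep : countSets p (d + 1) (k + 1) acc =
        countSets p d (k + 1) acc + countSets p d k (acc + 2 ^ d) := rfl
      rw [hstep, Finset.range_add_one, Finset.powersetCard_succ_insert Finset.notMem_range_self,
        Finset.filter_union]
      refine (Finset.card_union_le _ _).trans (Nat.add_le_add (ih _ _ ?_) ?_)
      · exact hzero
      · rw [Finset.filter_image]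
        refine Finset.card_image_le.trans ((le_of_eq ?_).trans (ih k (acc + 2 ^ d) ?_))
        · congr 1
          refine Finset.filter_congr fun S hS => ?_
          have hd : d ∉ S := fun h => by
            simpa using (Finset.mem_powersetCard.1 hS).1 h
          rw [maskOf, Finset.sum_insert hd, ← add_assoc]
          rfl
        · intro s
          rw [Finset.powersetCard_zero, Finset.filter_singleton]
          cases h : p (acc + 2 ^ d) <;> simp [maskOf, h]

lemma wcount_le_goodCount (hn : n ≤ 8) :
    wcount K (Finset.range n) k ≤ goodCount n (codeOf K n) k := by
  classical
  refine le_trans ?_ (card_filter_le_countSets _ n k 0)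
  unfold wcount
  refine Finset.card_le_card fun S hS => ?_
  rw [Finset.mem_filter] at hS ⊢
  refine ⟨hS.1, ?_⟩
  rw [zero_add, forced_eq]
  cases h : isBad n (codeOf K n) (maskOf S)
  · rfl
  · exact absurd hS.2 (isBad_sound hn (Finset.mem_powersetCard.1 hS.1).1 h)

lemma minDegTwo_of_degIn (hn : n ≤ 8) (h : ∀ i < n, 2 ≤ degIn K (Finset.range n) i) :
    minDegTwo n (codeOf K n) = true := by
  have key : ∀ m ≤ n, minDegTwo m (codeOf K n) = true := by
    intro m
    induction m with
    | zero => intro _; rfl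
    | succ m ih =>
      intro hm
      have hstep : minDegTwo (m + 1) (codeOf K n) = cond (forced (rowOf (codeOf K n) m) fun N =>
        cond (Nat.beq N 0) true (Nat.beq N (Nat.pow 2 (Nat.log2 N)))) false
          (minDegTwo m (codeOf K n)) := rfl
      rw [hstep, forced_eq, ih (by omega), cond_false_left]
      refine ⟨?_, rfl⟩
      obtain ⟨a, ha, b, hb, hab⟩ := Finset.one_lt_card.1 (show 1 < _ from h m (by omega))
      rw [mem_nbrIn, Finset.mem_range] at ha hb
      have ha' := (testBit_rowOf hn (by omega) ha.1).2 ha.2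
      have hb' := (testBit_rowOf hn (by omega) hb.1).2 hb.2
      have h1 : Nat.beq (rowOf (codeOf K n) m) 0 = false := by
        rw [natBeq_eq_false]
        intro h0
        rw [h0] at ha'
        simp at ha'
      rw [h1]
      change Nat.beq _ _ = false
      rw [natBeq_eq_false]
      intro h0
      rw [h0] at ha' hb'
      change (2 ^ _).testBit a = true at ha'
      change (2 ^ _).testBit b = true at hb'
      rw [Nat.testBit_two_pow, decide_eq_true_iff] at ha' hb'
      exact hab (ha'.symm.trans hb')
  exact key n le_rfl

/-- `f` marks the edges that are present; the branch of the search that follows `f` ends in the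
graph in question. -/
lemma allGraphs_sound (f : ℕ × ℕ → Bool) (q : ℕ → Bool) (l : List (ℕ × ℕ)) (c R : ℕ)
    (h : allGraphs q l c R = true) (hc : (l.filter f).length = c) :
    q (R + ((l.filter f).map edgeCode).sum) = true := by
  induction l generalizing c R with
  | nil =>
    obtain rfl : c = 0 := by simpa using hc.symm
    have : forced R q = true := h
    rw [forced_eq] at this
    simpa using this
  | cons e l ih =>
    rcases c with _ | c
    · have : forced R q = true := h
      rw [forced_eq] at this
      rw [List.length_eq_zero_iff] at hc
      rw [hc]
      simpa using this
    · have hstep : cond (allGraphs q l (c + 1) R) (allGraphs q l c (R + edgeCode e)) false = true :=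
        h
      rw [cond_false_right] at hstep
      cases hf : f e
      · rw [List.filter_cons_of_neg (by simp [hf])] at hc ⊢
        exact ih (c + 1) R hstep.1 hc
      · rw [List.filter_cons_of_pos (by simp [hf])] at hc ⊢
        rw [List.map_cons, List.sum_cons, ← add_assoc]
        exact ih c _ hstep.2 (by simpa using hc)

lemma sum_pairsBelow (F : ℕ → ℕ → ℕ) (hF : ∀ i, F i i = 0) (n : ℕ) :
    ∑ i ∈ Finset.range n, ∑ j ∈ Finset.range n, F i j =
      ((pairsBelow n).map fun e => F e.1 e.2 + F e.2 e.1).sum := by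
  induction n with
  | zero => rfl
  | succ n ih =>
    rw [pairsBelow, List.map_append, List.sum_append, ← ih, List.map_map, Finset.sum_range_succ]
    simp only [Finset.sum_range_succ, Finset.sum_add_distrib, hF, add_zero]
    have : (List.map ((fun e : ℕ × ℕ => F e.1 e.2 + F e.2 e.1) ∘ fun i => (i, n))
        (List.range n)).sum = ∑ i ∈ Finset.range n, (F i n + F n i) := rfl
    rw [this, Finset.sum_add_distrib]
    ring

/-- If the edges at the first `s` vertices are known, then a property verified by `allGraphs` holds
for `K`. -/
lemma allGraphs_codeOf (q : ℕ → Bool) (s c : ℕ) (known : ℕ × ℕ → Bool)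
    (hknown : ∀ e ∈ pairsBelow n, e.1 < s → (K.Adj e.1 e.2 ↔ known e = true))
    (hdeg : degSum K (Finset.range n) =
      2 * (((pairsBelow n).filter fun e => decide (e.1 < s) && known e).length + c))
    (h : allGraphs q (freePairs s n) c
      (((pairsBelow n).filter fun e => decide (e.1 < s) && known e).map edgeCode).sum = true) :
    q (codeOf K n) = true := by
  classical
  -- A sum over the edges splits into known and free edges. With the constant `2` this counts the
  -- free edges, with `edgeCode` it gives the code.
  have hsplit : ∀ (F : ℕ × ℕ → ℕ) (l : List (ℕ × ℕ)), (∀ e ∈ l, e ∈ pairsBelow n) →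
      (l.map fun e => if K.Adj e.1 e.2 then F e else 0).sum =
      ((l.filter fun e => decide (e.1 < s) && known e).map F).sum +
      (((l.filter fun e => s ≤ e.1).filter fun e => decide (K.Adj e.1 e.2)).map F).sum := by
    intro F l hl
    induction l with
    | nil => rfl
    | cons e l ih =>
      rw [List.map_cons, List.sum_cons, ih fun e' he' => hl e' (List.mem_cons_of_mem _ he')]
      have hk := hknown e (hl e List.mem_cons_self)
      by_cases hs : e.1 < s
      · rw [List.filter_cons_of_neg (p := fun e : ℕ × ℕ => decide (s ≤ e.1)) (by simpa using hs)]
        by_cases hadj : K.Adj e.1 e.2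
        · rw [if_pos hadj, List.filter_cons_of_pos (by simp [hs, (hk hs).1 hadj]), List.map_cons,
            List.sum_cons, add_assoc]
        · rw [if_neg hadj, List.filter_cons_of_neg, zero_add]
          rw [hk hs] at hadj
          simp [hadj]
      · rw [List.filter_cons_of_neg (p := fun e : ℕ × ℕ => decide (e.1 < s) && known e)
          (by simp [hs]), List.filter_cons_of_pos (p := fun e : ℕ × ℕ => decide (s ≤ e.1))
          (by simpa using hs)]
        by_cases hadj : K.Adj e.1 e.2
        · rw [if_pos hadj, List.filter_cons_of_pos (by simpa using hadj), List.map_cons,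
            List.sum_cons]
          ring
        · rw [if_neg hadj, List.filter_cons_of_neg (by simpa using hadj), zero_add]
  have hcode : codeOf K n = ((pairsBelow n).map fun e => if K.Adj e.1 e.2 then edgeCode e else 0).sum
      := by
    rw [codeOf, sum_pairsBelow _ fun i => by simp]
    congr 1
    refine List.map_congr_left fun e _ => ?_
    rw [K.adj_comm e.2 e.1]
    split_ifs <;> rfl
  have hdeg' : degSum K (Finset.range n) =
      ((pairsBelow n).map fun e => if K.Adj e.1 e.2 then 2 else 0).sum := by
    have : degSum K (Finset.range n) =
        ∑ i ∈ Finset.range n, ∑ j ∈ Finset.range n, if K.Adj i j then 1 else 0 := by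
      refine Finset.sum_congr rfl fun i _ => ?_
      rw [← Finset.sum_filter, ← Finset.card_eq_sum_ones]
      unfold degIn nbrIn
      congr
    rw [this, sum_pairsBelow _ fun i => by simp]
    congr 1
    refine List.map_congr_left fun e _ => ?_
    rw [K.adj_comm e.2 e.1]
    split_ifs <;> rfl
  have hlen := hsplit (fun _ => 2) (pairsBelow n) fun _ h => h
  rw [← hdeg', hdeg] at hlen
  simp only [List.map_const', List.sum_replicate, smul_eq_mul] at hlen
  rw [hcode, hsplit edgeCode (pairsBelow n) fun _ h => h]
  exact allGraphs_sound _ q _ c _ h (by omega)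

end sound

/-! ### Transfer to graphs on the natural numbers. -/

section transfer
variable {V : Type*} [DecidableEq V] {G : SimpleGraph V} {A : Finset V} {n k : ℕ}

/-- The vertices of `A` can be numbered so that prescribed ones come first. -/
lemma exists_numbering (l : List V) (hl : l.Nodup) (hlA : ∀ x ∈ l, x ∈ A) (hl0 : l ≠ []) :
    ∃ g : ℕ → V, Set.InjOn g (Finset.range A.card) ∧ (Finset.range A.card).image g = A ∧
      ∀ (i : ℕ) (hi : i < l.length), g i = l[i] := by
  set L := l ++ (A \ l.toFinset).toList
  have hsub : l.toFinset ⊆ A := fun x hx => hlA x (List.mem_toFinset.1 hx)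
  have hlen : L.length = A.card := by
    rw [List.length_append, Finset.length_toList, Finset.card_sdiff_of_subset hsub,
      List.toFinset_card_of_nodup hl]
    have := Finset.card_le_card hsub
    rw [List.toFinset_card_of_nodup hl] at this
    omega
  have hnodup : L.Nodup := by
    rw [List.nodup_append]
    refine ⟨hl, Finset.nodup_toList _, ?_⟩
    intro a ha b hb
    rintro rfl
    rw [Finset.mem_toList, Finset.mem_sdiff, List.mem_toFinset] at hb
    exact hb.2 ha
  have hmem : ∀ x, x ∈ L ↔ x ∈ A := by
    intro x
    rw [List.mem_append, Finset.mem_toList, Finset.mem_sdiff, List.mem_toFinset]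
    have := hlA x
    tauto
  have hget : ∀ (i : ℕ) (hi : i < L.length), L.getD i (l.head hl0) = L[i] :=
    fun i hi => List.getD_eq_getElem _ _ hi
  refine ⟨fun i => L.getD i (l.head hl0), ?_, ?_, ?_⟩
  · intro i hi j hj h
    simp only [Finset.coe_range, Set.mem_Iio] at hi hj
    simp only at h
    rw [hget i (by omega), hget j (by omega)] at h
    exact (hnodup.getElem_inj_iff).1 h
  · ext x
    rw [Finset.mem_image, ← hmem, List.mem_iff_getElem]
    constructor
    · rintro ⟨i, hi, rfl⟩
      rw [Finset.mem_range] at hi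
      exact ⟨i, by omega, (hget i (by omega)).symm⟩
    · rintro ⟨i, hi, rfl⟩
      exact ⟨i, Finset.mem_range.2 (by omega), hget i hi⟩
  · intro i hi
    have hi' : i < L.length := by rw [List.length_append]; omega
    simp only
    rw [hget i hi', List.getElem_append_left]

variable {g : ℕ → V} {B S : Finset ℕ}

lemma degIn_comap (hg : Set.InjOn g B) (i : ℕ) :
    degIn (G.comap g) B i = degIn G (B.image g) (g i) := by
  classical
  unfold degIn
  have : nbrIn G (B.image g) (g i) = (nbrIn (G.comap g) B i).image g := by
    ext y
    simp only [mem_nbrIn, Finset.mem_image, SimpleGraph.comap_adj]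
    constructor
    · rintro ⟨⟨a, ha, rfl⟩, h⟩
      exact ⟨a, ⟨ha, h⟩, rfl⟩
    · rintro ⟨a, ⟨ha, h⟩, rfl⟩
      exact ⟨⟨a, ha, rfl⟩, h⟩
  rw [this, Finset.card_image_of_injOn]
  exact hg.mono fun x hx => (mem_nbrIn.1 (Finset.mem_coe.1 hx)).1

lemma Good.comap (hg : Set.InjOn g B) (hSB : S ⊆ B) (h : Good G (S.image g)) :
    Good (G.comap g) S := by
  have hmem : ∀ T ⊆ S, ∀ a ∈ S, g a ∈ T.image g → a ∈ T := by
    intro T hT a ha h'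
    rw [Finset.mem_image] at h'
    obtain ⟨b, hb, hab⟩ := h'
    exact hg (hSB (hT hb)) (hSB ha) hab ▸ hb
  constructor
  · intro T hT hne hTS
    obtain ⟨x, hx, y, hy, hyT, hadj⟩ := h.1 (T.image g) (Finset.image_subset_image hT)
      (hne.image g) (by
        intro h'
        apply hTS
        refine hT.antisymm fun a ha => hmem T hT a ha ?_
        rw [h']
        exact Finset.mem_image_of_mem g ha)
    rw [Finset.mem_image] at hx hy
    obtain ⟨a, ha, rfl⟩ := hx
    obtain ⟨b, hb, rfl⟩ := hy
    exact ⟨a, ha, b, hb, fun h' => hyT (Finset.mem_image_of_mem g h'), hadj⟩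
  · intro H hH hhole
    refine h.2 (H.image g) (Finset.image_subset_image hH) ⟨hhole.1.image g, ?_⟩
    intro x hx
    rw [Finset.mem_image] at hx
    obtain ⟨a, ha, rfl⟩ := hx
    obtain ⟨y, hy, z, hz, hyz, h1, h2, h3, h4⟩ := hhole.2 a ha
    refine ⟨g y, Finset.mem_image_of_mem g hy, g z, Finset.mem_image_of_mem g hz,
      fun h' => hyz (hg (hSB (hH hy)) (hSB (hH hz)) h'), h1, h2, h3, ?_⟩
    intro t ht hadj
    rw [Finset.mem_image] at ht
    obtain ⟨b, hb, rfl⟩ := ht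
    exact (h4 b hb hadj).imp (congrArg g) (congrArg g)

lemma wcount_image_le (hg : Set.InjOn g B) :
    wcount G (B.image g) k ≤ wcount (G.comap g) B k := by
  classical
  unfold wcount
  have himg : ∀ S ⊆ B.image g, (B.filter fun i => g i ∈ S).image g = S := by
    intro S hS
    ext x
    rw [Finset.mem_image]
    constructor
    · rintro ⟨a, ha, rfl⟩
      exact (Finset.mem_filter.1 ha).2
    · intro hx
      obtain ⟨a, ha, rfl⟩ := Finset.mem_image.1 (hS hx)
      exact ⟨a, Finset.mem_filter.2 ⟨ha, hx⟩, rfl⟩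
  refine Finset.card_le_card_of_injOn (fun S => B.filter fun i => g i ∈ S) ?_ ?_
  · intro S hS
    simp only [Finset.coe_filter, Finset.mem_powersetCard, Set.mem_ofPred_eq] at hS ⊢
    refine ⟨⟨Finset.filter_subset _ _, ?_⟩, ?_⟩
    · rw [← Finset.card_image_of_injOn (hg.mono fun x hx => (Finset.mem_filter.1 hx).1), himg S hS.1.1, hS.1.2]
    · refine Good.comap hg (Finset.filter_subset _ _) ?_
      rw [himg S hS.1.1]
      exact hS.2
  · intro S hS T hT h
    simp only [Finset.coe_filter, Finset.mem_powersetCard, Set.mem_ofPred_eq] at hS hT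
    simp only at h
    rw [← himg S hS.1.1, h, himg T hT.1.1]

lemma degSum_comap (hg : Set.InjOn g B) :
    degSum (G.comap g) B = degSum G (B.image g) := by
  unfold degSum
  rw [Finset.sum_image hg]
  exact Finset.sum_congr rfl fun i _ => degIn_comap hg i

end transfer

/-! ### Bicyclic graphs of minimum degree two and their enumeration for orders five to seven. -/

section cores
variable {V : Type*} [DecidableEq V] {G : SimpleGraph V} {A : Finset V} {n k : ℕ} {g : ℕ → V}

/-- All degrees are two except for one vertex of degree four or two of degree three. -/
lemma sum_degIn_sub_two (hsum : degSum G A = 2 * A.card + 2)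
    (hcore : ∀ x ∈ A, 2 ≤ degIn G A x) : ∑ x ∈ A, (degIn G A x - 2) = 2 := by
  have : ∑ x ∈ A, (degIn G A x - 2) + ∑ x ∈ A, 2 = degSum G A := by
    rw [← Finset.sum_add_distrib]
    exact Finset.sum_congr rfl fun x hx => Nat.sub_add_cancel (hcore x hx)
  rw [Finset.sum_const, smul_eq_mul] at this
  omega

/-- A large bicyclic graph of minimum degree two has two adjacent vertices of degree two. -/
lemma exists_adj_degIn_two (hsum : degSum G A = 2 * A.card + 2)
    (hcore : ∀ x ∈ A, 2 ≤ degIn G A x) (hA : 6 ≤ A.card) :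
    ∃ v ∈ A, ∃ w ∈ A, G.Adj v w ∧ degIn G A v = 2 ∧ degIn G A w = 2 := by
  classical
  -- If the set `D` of degree-two vertices were independent, its `2 * D.card` edges would end in the
  -- set `E` of at most two other vertices, whose degrees sum to at most six. That leaves at most
  -- five vertices, as in `K_{2,3}`.
  by_contra! hcon
  have h2 := sum_degIn_sub_two hsum hcore
  set D := A.filter fun x => degIn G A x = 2
  set E := A.filter fun x => ¬ degIn G A x = 2
  have hDE : D.card + E.card = A.card := Finset.card_filter_add_card_filter_not _
  have hE2 : ∑ x ∈ E, (degIn G A x - 2) = 2 := by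
    refine Eq.trans ?_ h2
    rw [Finset.sum_filter]
    refine Finset.sum_congr rfl fun x _ => ?_
    split_ifs with h
    · omega
    · rfl
  have hEcard : E.card ≤ 2 := by
    rw [Finset.card_eq_sum_ones, ← hE2]
    refine Finset.sum_le_sum fun x hx => ?_
    rw [Finset.mem_filter] at hx
    have := hcore x hx.1
    omega
  have hEsum : ∑ x ∈ E, degIn G A x ≤ 6 := by
    have : ∑ x ∈ E, degIn G A x = ∑ x ∈ E, ((degIn G A x - 2) + 2) := by
      refine Finset.sum_congr rfl fun x hx => ?_
      rw [Finset.mem_filter] at hx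
      have := hcore x hx.1
      omega
    rw [this, Finset.sum_add_distrib, hE2, Finset.sum_const, smul_eq_mul]
    omega
  have hcount : ∑ x ∈ D, degIn G A x ≤ ∑ y ∈ E, degIn G A y := by
    have h3 : ∀ x ∈ D, degIn G A x = (E.filter fun y => G.Adj x y).card := by
      intro x hx
      rw [Finset.mem_filter] at hx
      unfold degIn
      congr 1
      ext y
      rw [mem_nbrIn, Finset.mem_filter, Finset.mem_filter]
      constructor
      · rintro ⟨h5, h6⟩
        exact ⟨⟨h5, fun h7 => hcon x hx.1 y h5 h6 hx.2 h7⟩, h6⟩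
      · rintro ⟨⟨h5, -⟩, h6⟩
        exact ⟨h5, h6⟩
    rw [Finset.sum_congr rfl h3]
    have h4 := Finset.sum_card_bipartiteAbove_eq_sum_card_bipartiteBelow (s := D) (t := E)
      (fun x y => G.Adj x y)
    unfold Finset.bipartiteAbove Finset.bipartiteBelow at h4
    rw [h4]
    refine Finset.sum_le_sum fun y hy => Finset.card_le_card fun x hx => ?_
    rw [Finset.mem_filter] at hx
    rw [mem_nbrIn]
    exact ⟨(Finset.mem_filter.1 hx.1).1, hx.2.symm⟩
  have hDsum : ∑ x ∈ D, degIn G A x = 2 * D.card := by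
    rw [Finset.sum_congr rfl fun x hx => (Finset.mem_filter.1 hx).2, Finset.sum_const, smul_eq_mul,
      mul_comm]
  omega

lemma lt_of_mem_pairsBelow {e : ℕ × ℕ} (h : e ∈ pairsBelow n) : e.1 < e.2 ∧ e.2 < n := by
  induction n with
  | zero => simp [pairsBelow] at h
  | succ n ih =>
    rw [pairsBelow, List.mem_append, List.mem_map] at h
    rcases h with h | ⟨i, hi, rfl⟩
    · have := ih h
      omega
    · simpa using hi

lemma comap_adj_iff (hg : Set.InjOn g (Finset.range n)) (himg : (Finset.range n).image g = A)
    {i a b j : ℕ} (ha : a < n) (hb : b < n) (hj : j < n) (hn : nbrIn G A (g i) = {g a, g b}) :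
    (G.comap g).Adj i j ↔ j = a ∨ j = b := by
  have hinj : ∀ c < n, g j = g c ↔ j = c := fun c hc =>
    hg.eq_iff (by simpa using hj) (by simpa using hc)
  have hmem : g j ∈ A := himg ▸ Finset.mem_image_of_mem g (Finset.mem_range.2 hj)
  rw [← hinj a ha, ← hinj b hb, SimpleGraph.comap_adj]
  have : g j ∈ nbrIn G A (g i) ↔ G.Adj (g i) (g j) := by
    rw [mem_nbrIn]
    exact and_iff_right hmem
  rw [← this, hn, Finset.mem_insert, Finset.mem_singleton]

/-- The code of a graph whose edges at the vertices `0, …, s - 1` are given by `known`. -/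
def startCode (n s : ℕ) (known : ℕ × ℕ → Bool) : ℕ :=
  (((pairsBelow n).filter fun e => decide (e.1 < s) && known e).map edgeCode).sum

def knownCherry (e : ℕ × ℕ) : Bool := e == (0, 1) || e == (0, 2)

def knownTriangle (e : ℕ × ℕ) : Bool := e == (0, 1) || e == (0, 2) || e == (1, 2)

/-- The path `2, 0, 1, 3`, whose inner vertices have degree two. -/
def knownPath (e : ℕ × ℕ) : Bool := e == (0, 1) || e == (0, 2) || e == (1, 3)

/-- A vertex of degree two is numbered `0` and its neighbours `1` and `2`, which leaves `n - 1`
edges to enumerate. -/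
lemma exists_numbering_cherry (q : ℕ → Bool) (hA : A.card = n) (hn : 4 ≤ n)
    (hsum : degSum G A = 2 * n + 2) (hcore : ∀ x ∈ A, 2 ≤ degIn G A x)
    (hlen : ((pairsBelow n).filter fun e => decide (e.1 < 1) && knownCherry e).length = 2)
    (hq : allGraphs q (freePairs 1 n) (n - 1) (startCode n 1 knownCherry) = true) :
    ∃ g : ℕ → V, Set.InjOn g (Finset.range n) ∧ (Finset.range n).image g = A ∧
      q (codeOf (G.comap g) n) = true := by
  obtain ⟨v, hv, hd⟩ : ∃ v ∈ A, degIn G A v = 2 := by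
    by_contra! hcon
    have h1 : ∑ x ∈ A, 1 ≤ ∑ x ∈ A, (degIn G A x - 2) := Finset.sum_le_sum fun x hx => by
      have := hcore x hx
      have := hcon x hx
      omega
    rw [sum_degIn_sub_two (by omega) hcore, ← Finset.card_eq_sum_ones] at h1
    omega
  obtain ⟨u, w, huw, hn2⟩ := exists_nbrIn_eq_pair hd
  have hu : u ∈ A ∧ G.Adj v u := mem_nbrIn.1 (by rw [hn2]; simp)
  have hw : w ∈ A ∧ G.Adj v w := mem_nbrIn.1 (by rw [hn2]; simp)
  obtain ⟨g, hg, himg, hgl⟩ := exists_numbering (A := A) [v, u, w]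
    (by simp [huw, hu.2.ne, hw.2.ne]) (by simp [hv, hu.1, hw.1]) (by simp)
  rw [hA] at hg himg
  have g0 : g 0 = v := hgl 0 (by simp)
  have g1 : g 1 = u := hgl 1 (by simp)
  have g2 : g 2 = w := hgl 2 (by simp)
  have h0 : ∀ j < n, (G.comap g).Adj 0 j ↔ j = 1 ∨ j = 2 := fun j hj =>
    comap_adj_iff hg himg (by omega) (by omega) hj (by rw [g0, g1, g2, hn2])
  refine ⟨g, hg, himg, allGraphs_codeOf q 1 (n - 1) knownCherry ?_ ?_ hq⟩
  · rintro ⟨a, b⟩ he hlt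
    obtain ⟨h1, h2⟩ := lt_of_mem_pairsBelow he
    simp only at h1 h2 hlt
    obtain rfl : a = 0 := by omega
    exact (h0 b h2).trans (by simp [knownCherry])
  · rw [degSum_comap hg, himg, hsum, hlen]
    omega

/-- Two adjacent vertices of degree two meet three edges. Their other neighbours coincide (triangle)
or differ (path), and only `n - 2` edges among the remaining vertices have to be enumerated. -/
lemma exists_numbering_adj (q : ℕ → Bool) (hA : A.card = n) (hn : 6 ≤ n)
    (hsum : degSum G A = 2 * n + 2) (hcore : ∀ x ∈ A, 2 ≤ degIn G A x)
    (hlen : ((pairsBelow n).filter fun e => decide (e.1 < 2) && knownTriangle e).length = 3)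
    (hlen' : ((pairsBelow n).filter fun e => decide (e.1 < 2) && knownPath e).length = 3)
    (hq : allGraphs q (freePairs 2 n) (n - 2) (startCode n 2 knownTriangle) = true)
    (hq' : allGraphs q (freePairs 2 n) (n - 2) (startCode n 2 knownPath) = true) :
    ∃ g : ℕ → V, Set.InjOn g (Finset.range n) ∧ (Finset.range n).image g = A ∧
      q (codeOf (G.comap g) n) = true := by
  obtain ⟨v, hv, w, hw, hvw, hdv, hdw⟩ := exists_adj_degIn_two (by omega) hcore (by omega)
  have other : ∀ a ∈ A, ∀ b ∈ A, G.Adj a b → degIn G A a = 2 →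
      ∃ c ∈ A, c ≠ b ∧ G.Adj a c ∧ nbrIn G A a = {b, c} := by
    intro a _ b hb hab hda
    obtain ⟨c, d, hcd, hn2⟩ := exists_nbrIn_eq_pair hda
    have hc : c ∈ A ∧ G.Adj a c := mem_nbrIn.1 (by rw [hn2]; simp)
    have hd : d ∈ A ∧ G.Adj a d := mem_nbrIn.1 (by rw [hn2]; simp)
    have hb' : b ∈ nbrIn G A a := mem_nbrIn.2 ⟨hb, hab⟩
    rw [hn2, Finset.mem_insert, Finset.mem_singleton] at hb'
    rcases hb' with rfl | rfl
    · exact ⟨d, hd.1, hcd.symm, hd.2, hn2⟩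
    · exact ⟨c, hc.1, hcd, hc.2, by rw [hn2, Finset.pair_comm]⟩
  obtain ⟨u, huA, huw, hvu, hnv⟩ := other v hv w hw hvw hdv
  obtain ⟨x, hxA, hxv, hwx, hnw⟩ := other w hw v hv hvw.symm hdw
  by_cases hxu : x = u
  · subst hxu
    obtain ⟨g, hg, himg, hgl⟩ := exists_numbering (A := A) [v, w, x]
      (by simp [hvw.ne, hvu.ne, huw.symm]) (by simp [hv, hw, hxA]) (by simp)
    rw [hA] at hg himg
    have g0 : g 0 = v := hgl 0 (by simp)
    have g1 : g 1 = w := hgl 1 (by simp)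
    have g2 : g 2 = x := hgl 2 (by simp)
    have h0 : ∀ j < n, (G.comap g).Adj 0 j ↔ j = 1 ∨ j = 2 := fun j hj =>
      comap_adj_iff hg himg (by omega) (by omega) hj (by rw [g0, g1, g2, hnv])
    have h1 : ∀ j < n, (G.comap g).Adj 1 j ↔ j = 0 ∨ j = 2 := fun j hj =>
      comap_adj_iff hg himg (by omega) (by omega) hj (by rw [g0, g1, g2, hnw])
    refine ⟨g, hg, himg, allGraphs_codeOf q 2 (n - 2) knownTriangle ?_ ?_ hq⟩
    · rintro ⟨a, b⟩ he hlt
      obtain ⟨h3, h2⟩ := lt_of_mem_pairsBelow he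
      simp only at h3 h2 hlt
      obtain rfl | rfl : a = 0 ∨ a = 1 := by omega
      · exact (h0 b h2).trans (by simp [knownTriangle])
      · have : b ≠ 0 := by omega
        exact (h1 b h2).trans (by simp [knownTriangle, this])
    · rw [degSum_comap hg, himg, hsum, hlen]
      omega
  · obtain ⟨g, hg, himg, hgl⟩ := exists_numbering (A := A) [v, w, u, x]
      (by simp [hvw.ne, hvu.ne, huw.symm, hxv.symm, hwx.ne, Ne.symm hxu])
      (by simp [hv, hw, hxA, huA]) (by simp)
    rw [hA] at hg himg
    have g0 : g 0 = v := hgl 0 (by simp)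
    have g1 : g 1 = w := hgl 1 (by simp)
    have g2 : g 2 = u := hgl 2 (by simp)
    have g3 : g 3 = x := hgl 3 (by simp)
    have h0 : ∀ j < n, (G.comap g).Adj 0 j ↔ j = 1 ∨ j = 2 := fun j hj =>
      comap_adj_iff hg himg (by omega) (by omega) hj (by rw [g0, g1, g2, hnv])
    have h1 : ∀ j < n, (G.comap g).Adj 1 j ↔ j = 0 ∨ j = 3 := fun j hj =>
      comap_adj_iff hg himg (by omega) (by omega) hj (by rw [g0, g1, g3, hnw])
    refine ⟨g, hg, himg, allGraphs_codeOf q 2 (n - 2) knownPath ?_ ?_ hq'⟩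
    · rintro ⟨a, b⟩ he hlt
      obtain ⟨h3, h2⟩ := lt_of_mem_pairsBelow he
      simp only at h3 h2 hlt
      obtain rfl | rfl : a = 0 ∨ a = 1 := by omega
      · exact (h0 b h2).trans (by simp [knownPath])
      · have : b ≠ 0 := by omega
        exact (h1 b h2).trans (by simp [knownPath, this])
    · rw [degSum_comap hg, himg, hsum, hlen']
      omega

lemma wcount_le_goodCount_comap (hn : n ≤ 8) (hg : Set.InjOn g (Finset.range n))
    (himg : (Finset.range n).image g = A) :
    wcount G A k ≤ goodCount n (codeOf (G.comap g) n) k := by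
  rw [← himg]
  exact (wcount_image_le hg).trans (wcount_le_goodCount hn)

lemma minDegTwo_comap (hn : n ≤ 8) (hg : Set.InjOn g (Finset.range n))
    (himg : (Finset.range n).image g = A) (hcore : ∀ x ∈ A, 2 ≤ degIn G A x) :
    minDegTwo n (codeOf (G.comap g) n) = true := by
  refine minDegTwo_of_degIn hn fun i hi => ?_
  rw [degIn_comap hg, himg]
  exact hcore _ (himg ▸ Finset.mem_image_of_mem g (Finset.mem_range.2 hi))

lemma bitOf_rowOf_comap (hn : n ≤ 8) {i j : ℕ} (hi : i < n) (hj : j < n) :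
    bitOf (rowOf (codeOf (G.comap g) n) i) j = true ↔ G.Adj (g i) (g j) := by
  rw [bitOf_eq, testBit_rowOf hn hi hj, SimpleGraph.comap_adj]

/-- The number `4` is `(5 - 1).choose 3`; `9` and `7` are the two bounds of `wcount_three_bicyclic`
at order five, the smaller one required only if some vertex is universal. -/
def checkFive (R : ℕ) : Bool :=
  !minDegTwo 5 R || (Nat.ble (goodCount 5 R 4) 4 && Nat.ble (goodCount 5 R 3) 9 &&
    (Nat.ble (goodCount 5 R 3) 7 || !existsBelow (fun u => !existsBelow (fun y =>
      !Nat.beq y u && !bitOf (rowOf R u) y) 5) 5))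

/-- The binomial bounds are `5` and `10`. Eleven four-sets are tolerated if each `u` admits `y` and
`z` with `y` adjacent to neither `u` nor `z`: a pendant vertex at `u` then lies in a disconnected
four-set with these. -/
def checkSix (R : ℕ) : Bool :=
  !minDegTwo 6 R || (Nat.ble (goodCount 6 R 5) 5 && (Nat.ble (goodCount 6 R 4) 10 ||
    Nat.ble (goodCount 6 R 4) 11 && !existsBelow (fun u => !existsBelow (fun y =>
      existsBelow (fun z => !Nat.beq y u && !Nat.beq z u && !Nat.beq y z &&
        !bitOf (rowOf R y) u && !bitOf (rowOf R y) z) 6) 6) 6))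

/-- The constants are `Nat.choose 6 3`, `Nat.choose 6 4` and `Nat.choose 6 5`. -/
def checkSeven (R : ℕ) : Bool :=
  !minDegTwo 7 R || (Nat.ble (goodCount 7 R 4) 20 && Nat.ble (goodCount 7 R 5) 15 &&
    Nat.ble (goodCount 7 R 6) 6)

lemma allGraphs_checkFive :
    allGraphs checkFive (freePairs 1 5) 4 (startCode 5 1 knownCherry) = true := by
  decide +kernel

lemma allGraphs_checkSix_triangle :
    allGraphs checkSix (freePairs 2 6) 4 (startCode 6 2 knownTriangle) = true := by
  decide +kernel

lemma allGraphs_checkSix_path :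
    allGraphs checkSix (freePairs 2 6) 4 (startCode 6 2 knownPath) = true := by
  decide +kernel

lemma allGraphs_checkSeven_triangle :
    allGraphs checkSeven (freePairs 2 7) 5 (startCode 7 2 knownTriangle) = true := by
  decide +kernel

lemma allGraphs_checkSeven_path :
    allGraphs checkSeven (freePairs 2 7) 5 (startCode 7 2 knownPath) = true := by
  decide +kernel

/-- Bicyclic graphs of order five and minimum degree two. -/
lemma core_five (hA : A.card = 5) (hsum : degSum G A = 12) (hcore : ∀ x ∈ A, 2 ≤ degIn G A x) :
    wcount G A 4 ≤ 4 ∧ wcount G A 3 ≤ 9 ∧ ((∃ u ∈ A, degIn G A u = 4) → wcount G A 3 ≤ 7) := by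
  obtain ⟨g, hg, himg, h⟩ := exists_numbering_cherry checkFive hA (by norm_num) hsum hcore
    (by decide) allGraphs_checkFive
  have hc := fun k => wcount_le_goodCount_comap (G := G) (k := k) (show 5 ≤ 8 by norm_num) hg himg
  rw [checkFive, minDegTwo_comap (by norm_num) hg himg hcore] at h
  simp only [Bool.not_true, Bool.false_or, Bool.and_eq_true, Bool.or_eq_true, Nat.ble_eq] at h
  obtain ⟨⟨h4, h9⟩, h7⟩ := h
  refine ⟨(hc 4).trans h4, (hc 3).trans h9, ?_⟩
  rintro ⟨u, hu, hdu⟩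
  rcases h7 with h7 | h7
  · exact (hc 3).trans h7
  exfalso
  rw [← himg, Finset.mem_image] at hu
  obtain ⟨i, hi, rfl⟩ := hu
  rw [Finset.mem_range] at hi
  rw [Bool.not_eq_true', ← Bool.not_eq_true, existsBelow_iff] at h7
  push Not at h7
  have h8 := h7 i hi
  simp only [Bool.not_eq_true, Bool.not_eq_false', existsBelow_iff, Bool.and_eq_true,
    Bool.not_eq_true', natBeq_eq_false] at h8
  obtain ⟨j, hj, hji, hadj⟩ := h8
  rw [← Bool.not_eq_true, bitOf_rowOf_comap (by norm_num) hi hj] at hadj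
  have hmem : ∀ a < 5, g a ∈ A := fun a ha =>
    himg ▸ Finset.mem_image_of_mem g (Finset.mem_range.2 ha)
  have hne : g j ≠ g i := fun h' => hji (hg (by simpa using hj) (by simpa using hi) h')
  have hsub : nbrIn G A (g i) ⊆ (A.erase (g i)).erase (g j) := by
    intro t ht
    rw [mem_nbrIn] at ht
    rw [Finset.mem_erase, Finset.mem_erase]
    exact ⟨fun h' => hadj (h' ▸ ht.2), ht.2.ne', ht.1⟩
  have hcard := Finset.card_le_card hsub
  rw [Finset.card_erase_of_mem (Finset.mem_erase.2 ⟨hne, hmem j hj⟩),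
    Finset.card_erase_of_mem (hmem i hi), hA] at hcard
  unfold degIn at hdu
  omega

/-- Bicyclic graphs of order six and minimum degree two. -/
lemma core_six (hA : A.card = 6) (hsum : degSum G A = 14) (hcore : ∀ x ∈ A, 2 ≤ degIn G A x) :
    wcount G A 5 ≤ 5 ∧ (wcount G A 4 ≤ 10 ∨ wcount G A 4 ≤ 11 ∧
      ∀ u ∈ A, ∃ y ∈ A, ∃ z ∈ A, y ≠ u ∧ z ≠ u ∧ y ≠ z ∧ ¬ G.Adj y u ∧ ¬ G.Adj y z) := by
  obtain ⟨g, hg, himg, h⟩ := exists_numbering_adj checkSix hA (by norm_num) hsum hcore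
    (by decide) (by decide) allGraphs_checkSix_triangle allGraphs_checkSix_path
  have hc := fun k => wcount_le_goodCount_comap (G := G) (k := k) (show 6 ≤ 8 by norm_num) hg himg
  rw [checkSix, minDegTwo_comap (by norm_num) hg himg hcore] at h
  simp only [Bool.not_true, Bool.false_or, Bool.and_eq_true, Bool.or_eq_true, Nat.ble_eq] at h
  obtain ⟨h5, h4⟩ := h
  refine ⟨(hc 5).trans h5, h4.imp (hc 4).trans fun h4 => ⟨(hc 4).trans h4.1, ?_⟩⟩
  intro u hu
  rw [← himg, Finset.mem_image] at hu
  obtain ⟨i, hi, rfl⟩ := hu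
  rw [Finset.mem_range] at hi
  have h7 := h4.2
  rw [Bool.not_eq_true', ← Bool.not_eq_true, existsBelow_iff] at h7
  push Not at h7
  have h8 := h7 i hi
  simp only [Bool.not_eq_true, Bool.not_eq_false', existsBelow_iff, Bool.and_eq_true,
    Bool.not_eq_true', natBeq_eq_false] at h8
  obtain ⟨y, hy, z, hz, ⟨⟨⟨hyi, hzi⟩, hyz⟩, hadj⟩, hadj'⟩ := h8
  rw [← Bool.not_eq_true, bitOf_rowOf_comap (by norm_num) hy hi] at hadj
  rw [← Bool.not_eq_true, bitOf_rowOf_comap (by norm_num) hy hz] at hadj'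
  have hmem : ∀ a < 6, g a ∈ A := fun a ha =>
    himg ▸ Finset.mem_image_of_mem g (Finset.mem_range.2 ha)
  have hne : ∀ a < 6, ∀ b < 6, a ≠ b → g a ≠ g b := fun a ha b hb hab h' =>
    hab (hg (by simpa using ha) (by simpa using hb) h')
  exact ⟨g y, hmem y hy, g z, hmem z hz, hne y hy i hi hyi, hne z hz i hi hzi, hne y hy z hz hyz,
    hadj, hadj'⟩

/-- Bicyclic graphs of order seven and minimum degree two. -/
lemma core_seven (hA : A.card = 7) (hsum : degSum G A = 16) (hcore : ∀ x ∈ A, 2 ≤ degIn G A x) :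
    wcount G A 4 ≤ 20 ∧ wcount G A 5 ≤ 15 ∧ wcount G A 6 ≤ 6 := by
  obtain ⟨g, hg, himg, h⟩ := exists_numbering_adj checkSeven hA (by norm_num) hsum hcore
    (by decide) (by decide) allGraphs_checkSeven_triangle allGraphs_checkSeven_path
  have hc := fun k => wcount_le_goodCount_comap (G := G) (k := k) (show 7 ≤ 8 by norm_num) hg himg
  rw [checkSeven, minDegTwo_comap (by norm_num) hg himg hcore] at h
  simp only [Bool.not_true, Bool.false_or, Bool.and_eq_true, Nat.ble_eq] at h
  exact ⟨(hc 4).trans h.1.1, (hc 5).trans h.1.2, (hc 6).trans h.2⟩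

end cores

/-! ### Upper bounds for bicyclic graphs. -/

section bicyclic
variable {V : Type*} [DecidableEq V] {G G' : SimpleGraph V} {A B S H : Finset V} {u v w x y : V}
  {k : ℕ}

lemma degIn_le_card_sub_one (hx : x ∈ A) : degIn G A x ≤ A.card - 1 := by
  rw [← Finset.card_erase_of_mem hx]
  refine Finset.card_le_card fun y hy => ?_
  rw [mem_nbrIn] at hy
  exact Finset.mem_erase.2 ⟨hy.2.ne', hy.1⟩

lemma four_le_card_of_degSum (hA : A.Nonempty) (hsum : degSum G A = 2 * A.card + 2) :
    4 ≤ A.card := by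
  by_contra! hlt
  have h1 : degSum G A ≤ ∑ x ∈ A, (A.card - 1) :=
    Finset.sum_le_sum fun x hx => degIn_le_card_sub_one hx
  rw [Finset.sum_const, smul_eq_mul, hsum] at h1
  have := Finset.card_pos.2 hA
  interval_cases A.card <;> omega

lemma degIn_le_four (hsum : degSum G A = 2 * A.card + 2)
    (hcore : ∀ x ∈ A, 2 ≤ degIn G A x) (hx : x ∈ A) : degIn G A x ≤ 4 := by
  have h1 := Finset.single_le_sum (f := fun x => degIn G A x - 2) (fun _ _ => Nat.zero_le _) hx
  rw [sum_degIn_sub_two hsum hcore] at h1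
  omega

/-- For degrees `d` from two to four, `d * (d - 1)` lies on or below its chord `2 + 5 * (d - 2)`,
and the excesses `d - 2` sum to two. -/
lemma wcount_three_core (hsum : degSum G A = 2 * A.card + 2)
    (hcore : ∀ x ∈ A, 2 ≤ degIn G A x) : wcount G A 3 ≤ A.card + 5 := by
  have h1 : ∑ x ∈ A, 2 * (degIn G A x).choose 2 ≤ ∑ x ∈ A, (2 + 5 * (degIn G A x - 2)) := by
    refine Finset.sum_le_sum fun x hx => ?_
    have h2 := hcore x hx
    have h3 := degIn_le_four hsum hcore hx
    interval_cases degIn G A x <;> decide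
  rw [← Finset.mul_sum, Finset.sum_add_distrib, ← Finset.mul_sum, sum_degIn_sub_two hsum hcore,
    Finset.sum_const, smul_eq_mul] at h1
  have := wcount_three_le (G := G) (A := A)
  omega

/-- A good triple through a pendant vertex `v` consists of `v`, its neighbour and a further
neighbour of the latter. -/
lemma wcountAt_three_pendant (hv : v ∈ A) (hn : nbrIn G A v = {u}) :
    wcountAt G A 3 v + 1 ≤ degIn G A u := by
  obtain ⟨huA, hvu⟩ := ne_of_nbrIn_singleton hn
  have hmem : v ∈ nbrIn G A u := mem_nbrIn.2 ⟨hv, hvu.symm⟩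
  have h1 : wcountAt G A 3 v ≤ _ := wcountAt_pendant_le_card (k := 1) hn
    (((nbrIn G A u).erase v).powersetCard 1) (by
      intro R hR hk hRn
      obtain ⟨r, rfl⟩ := Finset.card_eq_one.1 hk
      have hr : r ∈ (A.erase v).erase u := hR (Finset.mem_singleton_self r)
      rw [Finset.mem_erase, Finset.mem_erase] at hr
      have hur : ¬ G.Adj u r := by
        intro hadj
        apply hRn
        rw [Finset.mem_powersetCard]
        refine ⟨?_, rfl⟩
        rw [Finset.singleton_subset_iff, Finset.mem_erase, mem_nbrIn]
        exact ⟨hr.2.1, hr.2.2, hadj⟩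
      have hvr : ¬ G.Adj v r := by
        intro hadj
        have : r ∈ nbrIn G A v := mem_nbrIn.2 ⟨hr.2.2, hadj⟩
        rw [hn, Finset.mem_singleton] at this
        exact hr.1 this
      refine not_good_of_cut (T := {r}) (by simp) (by simp) ?_ ?_
      · intro h'
        have : v ∈ ({r} : Finset V) := by rw [h']; simp
        exact hr.2.1 (Finset.mem_singleton.1 this).symm
      · intro a ha b hb hbT hadj
        simp only [Finset.mem_singleton, Finset.mem_insert] at ha hb hbT
        subst ha
        rcases hb with rfl | rfl | rfl
        · exact hvr hadj.symm
        · exact hur hadj.symm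
        · exact hbT rfl)
  rw [Finset.card_powersetCard, Nat.choose_one_right] at h1
  have := Finset.card_erase_add_one hmem
  unfold degIn
  omega

/-- The bound on triples in bicyclic graphs. -/
lemma wcount_three_bicyclic (h : ConnSet G A) (hA : A.Nonempty)
    (hsum : degSum G A = 2 * A.card + 2) :
    wcount G A 3 ≤ (A.card - 1).choose 2 + 1 + (7 - A.card) ∧
    ((∃ u ∈ A, degIn G A u = A.card - 1) → wcount G A 3 ≤ (A.card - 1).choose 2 + 1) := by
  -- The truncated `7 - A.card` is an allowance for small orders: `K_{2,3}` has nine good triples,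
  -- two above the plain bound.
  induction hm : A.card generalizing A with
  | zero => exact absurd (Finset.card_pos.2 hA) (by omega)
  | succ m ih =>
    have h4 := four_le_card_of_degSum hA hsum
    rw [Nat.add_sub_cancel]
    by_cases hcore : ∀ x ∈ A, 2 ≤ degIn G A x
    · have hgen := wcount_three_core hsum hcore
      have h3 : wcount G A 3 ≤ _ := wcount_le_choose
      rcases Nat.lt_or_ge m 5 with hm5 | hm5
      · interval_cases m
        · omega
        · omega
        · omega
        · rw [hm] at h3
          have e1 : Nat.choose (3 + 1) 3 = 4 := rfl
          have e2 : Nat.choose 3 2 = 3 := rfl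
          constructor
          · omega
          · intro _; omega
        · obtain ⟨-, h9, h7⟩ := core_five (by omega) (by omega) hcore
          have e2 : Nat.choose 4 2 = 6 := rfl
          rw [e2]
          exact ⟨by omega, fun hu => h7 hu⟩
      · have hch : m + 5 ≤ m.choose 2 ∨ m = 5 := by
          rcases hm5.eq_or_lt with h | h
          · exact Or.inr h.symm
          · left
            obtain ⟨j, rfl⟩ := Nat.exists_eq_add_of_le h
            rw [Nat.choose_two_right, Nat.le_div_iff_mul_le two_pos,
              show 5 + 1 + j - 1 = j + 5 by omega]
            nlinarith
        constructor
        · rcases hch with hch | rfl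
          · omega
          · have e2 : Nat.choose 5 2 = 10 := rfl
            omega
        · rintro ⟨u, hu, hdu⟩
          have := degIn_le_four hsum hcore hu
          omega
    · push Not at hcore
      obtain ⟨v, hv, hd⟩ := hcore
      have hd1 : degIn G A v = 1 := by
        have := h.degIn_pos hv (by omega)
        omega
      obtain ⟨u, hu⟩ := exists_nbrIn_eq_singleton hd1
      obtain ⟨huA, hvu⟩ := ne_of_nbrIn_singleton hu
      have hc : (A.erase v).card = m := by rw [Finset.card_erase_of_mem hv, hm]; rfl
      have hs := degSum_erase (G := G) hv
      have hp := wcountAt_three_pendant hv hu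
      have huA' : u ∈ A.erase v := Finset.mem_erase.2 ⟨hvu.ne', huA⟩
      obtain ⟨i1, i2⟩ := ih (h.erase_pendant hu) ⟨u, huA'⟩ (by omega) hc
      have hdu := degIn_erase_of_adj hv hvu.symm
      have hle := degIn_le_card_sub_one (G := G) huA
      rw [wcount_eq G A 3 v]
      obtain ⟨l, rfl⟩ : ∃ l, m = l + 1 := ⟨m - 1, by omega⟩
      have hpas : (l + 1).choose 2 = l + l.choose 2 := by
        rw [Nat.choose_succ_succ' l 1, Nat.choose_one_right]
      rw [Nat.add_sub_cancel] at i1 i2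
      have huniv : degIn G A u = l + 1 → wcount G (A.erase v) 3 + wcountAt G A 3 v ≤
          (l + 1).choose 2 + 1 := by
        intro h'
        have := i2 ⟨u, huA', by omega⟩
        omega
      -- If `u` is not universal, `v` lies in at least one triple less than Pascal's rule permits,
      -- which pays for the shrinking allowance. If `u` is universal, it is so without `v` too, and
      -- the bound without allowance is inherited. Any universal vertex equals `u`, being adjacent
      -- to `v`.
      constructor
      · by_cases hdu' : degIn G A u = l + 1
        · have := huniv hdu'
          omega
        · omega
      · rintro ⟨x, hx, hdx⟩
        refine huniv ?_
        by_cases hxu : x = u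
        · rw [← hxu, hdx]
        · exfalso
          have hxv : x ≠ v := by rintro rfl; omega
          have hsub : nbrIn G A x ⊆ (A.erase x).erase v := by
            intro t ht
            rw [mem_nbrIn] at ht
            rw [Finset.mem_erase, Finset.mem_erase]
            refine ⟨?_, ht.2.ne', ht.1⟩
            rintro rfl
            have : x ∈ nbrIn G A t := mem_nbrIn.2 ⟨hx, ht.2.symm⟩
            rw [hu, Finset.mem_singleton] at this
            exact hxu this
          have := Finset.card_le_card hsub
          rw [Finset.card_erase_of_mem (Finset.mem_erase.2 ⟨Ne.symm hxv, hv⟩),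
            Finset.card_erase_of_mem hx] at this
          unfold degIn at hdx
          omega

/-- The bound for bicyclic graphs on at least `8` vertices of minimum degree two, given the bounds
for smaller graphs. -/
lemma wcount_core_step (h : ConnSet G A) (hsum : degSum G A = 2 * A.card + 2)
    (hcore : ∀ x ∈ A, 2 ≤ degIn G A x) (hA : 8 ≤ A.card)
    (ih : ∀ (G' : SimpleGraph V) (B : Finset V) (j : ℕ), ConnSet G' B →
      degSum G' B = 2 * B.card + 2 → B.card + 1 = A.card →
      wcount G' B (j + 4) ≤ (B.card - 1).choose (j + 3)) :
    wcount G A (k + 4) ≤ (A.card - 1).choose (k + 3) := by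
  obtain ⟨v, hv, z, hz, hvz, hdv, hdz⟩ := exists_adj_degIn_two hsum hcore (by omega)
  obtain ⟨u, w, huw, hn⟩ := exists_nbrIn_eq_pair hdv
  have hc : (A.erase v).card + 1 = A.card := Finset.card_erase_add_one hv
  have hs := degSum_erase (G := G) hv
  have hzA : z ∈ A.erase v := Finset.mem_erase.2 ⟨hvz.ne', hz⟩
  have hz1 := degIn_erase_of_adj (x := z) hv hvz.symm
  -- If connected, the graph without `v` is unicyclic, and not a cycle since `z` has become pendant.
  have huni : ConnSet G (A.erase v) → ∀ j, wcount G (A.erase v) (j + 3) ≤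
      ((A.erase v).card - 1).choose (j + 2) := fun hconn j =>
    wcount_unicyclic hconn (by omega) ⟨z, hzA, by omega⟩
  have hat : wcountAt G A (k + 4) v ≤ _ := wcountAt_le_suppress (k := k + 3) huw hn
  have hsup := h.suppress hv huw hn
  rw [wcount_eq G A (k + 4) v]
  obtain ⟨l, hl⟩ : ∃ l, (A.erase v).card = l + 1 := ⟨A.card - 2, by omega⟩
  have hpas : (l + 1).choose (k + 3) = l.choose (k + 2) + l.choose (k + 3) :=
    Nat.choose_succ_succ' _ _
  rw [hl, Nat.add_sub_cancel] at huni
  rw [show A.card - 1 = l + 1 by omega]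
  by_cases hadj : G.Adj u w
  · have hGG : G ⊔ SimpleGraph.edge u w = G := by
      ext a b
      rw [sup_edge_adj_iff huw]
      constructor
      · rintro (h | ⟨rfl, rfl⟩ | ⟨rfl, rfl⟩)
        · exact h
        · exact hadj
        · exact hadj.symm
      · exact Or.inl
    rw [hGG] at hat hsup
    have h1 := huni hsup k
    have h2 : wcount G (A.erase v) (k + 4) ≤ _ := huni hsup (k + 1)
    have e : l.choose (k + 1 + 2) = l.choose (k + 3) := rfl
    omega
  · have hss := degSum_suppress hv huw hn hadj
    have hih := fun j => ih _ _ j hsup (by omega) hc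
    rw [hl, Nat.add_sub_cancel] at hih
    have h1 : wcount (G ⊔ SimpleGraph.edge u w) (A.erase v) (k + 3) ≤ l.choose (k + 2) := by
      -- The induction hypothesis starts at four-sets; triples of the suppressed graph, again of
      -- minimum degree two, are bounded through the degrees.
      rcases k with _ | k
      · have h3 := wcount_three_core (G := G ⊔ SimpleGraph.edge u w) (A := A.erase v) (by omega)
          fun x hx => by
            rw [degIn_suppress hv huw hn hadj hx]
            exact hcore x (Finset.mem_of_mem_erase hx)
        refine h3.trans ?_
        rw [hl]
        obtain ⟨j, rfl⟩ := Nat.exists_eq_add_of_le (show 6 ≤ l by omega)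
        rw [zero_add, Nat.choose_two_right, Nat.le_div_iff_mul_le two_pos,
          show 6 + j - 1 = j + 5 by omega]
        nlinarith
      · exact hih k
    have h2 : wcount G (A.erase v) (k + 4) ≤ l.choose (k + 3) := by
      by_cases hconn : ConnSet G (A.erase v)
      · exact huni hconn (k + 1)
      · exact (wcount_erase_le_suppress h hv huw hn hconn).trans (hih k)
    omega

/-- The bound for bicyclic graphs and sets of at least four vertices; it has an exception of
order six. -/
lemma wcount_bicyclic_aux (h : ConnSet G A) (hA : A.Nonempty)
    (hsum : degSum G A = 2 * A.card + 2) :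
    wcount G A (k + 4) ≤ (A.card - 1).choose (k + 3) ∨
    (A.card = 6 ∧ k = 0 ∧ wcount G A 4 ≤ 11 ∧
      ∀ u ∈ A, ∃ y ∈ A, ∃ z ∈ A, y ≠ u ∧ z ≠ u ∧ y ≠ z ∧ ¬ G.Adj y u ∧ ¬ G.Adj y z) := by
  induction hm : A.card generalizing G A k with
  | zero => exact absurd (Finset.card_pos.2 hA) (by omega)
  | succ m ih =>
    have h4 := four_le_card_of_degSum hA hsum
    by_cases hk : m ≤ k + 3
    · left
      have := wcount_le_of_card_le (G := G) (k := k + 3) (A := A) (by omega) hA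
      rwa [hm] at this
    push Not at hk
    rw [Nat.add_sub_cancel]
    by_cases hcore : ∀ x ∈ A, 2 ≤ degIn G A x
    · rcases Nat.lt_or_ge m 7 with hm7 | hm7
      · interval_cases m
        any_goals omega
        · obtain rfl : k = 0 := by omega
          exact Or.inl (core_five hm (by omega) hcore).1
        · obtain ⟨h5, h6⟩ := core_six hm (by omega) hcore
          obtain rfl | rfl : k = 0 ∨ k = 1 := by omega
          · rcases h6 with h6 | h6
            · exact Or.inl h6
            · exact Or.inr ⟨rfl, rfl, h6⟩
          · exact Or.inl h5
        · obtain ⟨h5, h6, h7⟩ := core_seven hm (by omega) hcore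
          left
          obtain rfl | rfl | rfl : k = 0 ∨ k = 1 ∨ k = 2 := by omega
          · exact h5
          · exact h6
          · exact h7
      · left
        have := wcount_core_step (k := k) h hsum hcore (by omega) (fun G' B j hB hBs hBc => by
          rcases ih hB (Finset.card_pos.1 (by omega)) hBs (k := j) (by omega) with h1 | h1
          · rwa [show B.card = m by omega]
          · omega)
        rwa [hm, Nat.add_sub_cancel] at this
    · push Not at hcore
      left
      obtain ⟨v, hv, hd⟩ := hcore
      have hd1 : degIn G A v = 1 := by
        have := h.degIn_pos hv (by omega)
        omega
      obtain ⟨u, hu⟩ := exists_nbrIn_eq_singleton hd1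
      obtain ⟨huA, hvu⟩ := ne_of_nbrIn_singleton hu
      have hc : (A.erase v).card = m := by rw [Finset.card_erase_of_mem hv, hm]; rfl
      have hs := degSum_erase (G := G) hv
      have huA' : u ∈ A.erase v := Finset.mem_erase.2 ⟨hvu.ne', huA⟩
      rw [wcount_eq G A (k + 4) v]
      obtain ⟨l, rfl⟩ : ∃ l, m = l + 1 := ⟨m - 1, by omega⟩
      have hpas : (l + 1).choose (k + 3) = l.choose (k + 2) + l.choose (k + 3) :=
        Nat.choose_succ_succ' _ _
      have hl : A.card - 2 = l := by omega
      rcases ih (h.erase_pendant hu) ⟨u, huA'⟩ (by omega) (k := k) hc with h1 | ⟨h6, rfl, h11, hyz⟩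
      · have hp : wcountAt G A (k + 4) v ≤ _ := wcountAt_pendant (k := k + 2) hv hu
        rw [hl] at hp
        rw [Nat.add_sub_cancel] at h1
        omega
      -- The remainder may exceed its bound by one; the set of `v`, `u`, `y`, `z`, in which `y` is
      -- isolated, makes up for it.
      · obtain ⟨y, hy, z, hz, hyu, hzu, hyz, hayu, hayz⟩ := hyz u huA'
        have hp : wcountAt G A 4 v + 1 ≤ _ := wcountAt_pendant_lt (k := 2) hv hu (R := {y, z}) (by
          intro t; simp only [Finset.mem_insert, Finset.mem_singleton]
          rintro (rfl | rfl)
          · exact Finset.mem_erase.2 ⟨hyu, hy⟩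
          · exact Finset.mem_erase.2 ⟨hzu, hz⟩) (Finset.card_pair hyz) (by
          refine not_good_of_cut (T := {y}) ?_ (by simp) ?_ ?_
          · simp
          · intro h'
            have : u ∈ ({y} : Finset V) := by rw [h']; simp
            exact hyu (Finset.mem_singleton.1 this).symm
          · intro a ha b hb hbT hadj
            simp only [Finset.mem_singleton, Finset.mem_insert] at ha hb hbT
            subst ha
            rcases hb with rfl | rfl | rfl | rfl
            · have : a ∈ nbrIn G A b := mem_nbrIn.2 ⟨Finset.mem_of_mem_erase hy, hadj.symm⟩
              rw [hu, Finset.mem_singleton] at this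
              exact hyu this
            · exact hayu hadj
            · exact hbT rfl
            · exact hayz hadj)
        obtain rfl : l = 5 := by omega
        rw [hl] at hp
        have e1 : Nat.choose 5 2 = 10 := rfl
        have e2 : Nat.choose 6 3 = 20 := rfl
        have e3 : wcount G (A.erase v) (0 + 4) = wcount G (A.erase v) 4 := rfl
        have e4 : wcountAt G A (0 + 4) v = wcountAt G A 4 v := rfl
        norm_num at *
        omega

lemma wcount_bicyclic (h : ConnSet G A) (hA : 7 ≤ A.card)
    (hsum : degSum G A = 2 * A.card + 2) :
    wcount G A (k + 4) ≤ (A.card - 1).choose (k + 3) := by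
  rcases wcount_bicyclic_aux (k := k) h (Finset.card_pos.1 (by omega)) hsum with h1 | h1
  · exact h1
  · omega

end bicyclic

/-! ### The game: cop-win sets of a bicyclic graph are good. -/

section game

lemma robberHistory_succ {V : Type*} (r : ℕ → V) (t : ℕ) :
    robberHistory r (t + 1) = r t :: robberHistory r t := rfl

/-- A graph is not cop-win if the robber can always stay in safe positions: `safe c r` means that
the robber on `r` need not fear the cop on `c`, who is to move. -/
lemma not_isCopWin_of_safe {V : Type*} {G : SimpleGraph V} (safe : V → V → Prop)
    (h0 : ∀ c, ∃ r, safe c r) (hne : ∀ c r, safe c r → c ≠ r)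
    (hstep : ∀ c r c', safe c r → CopMove G c c' → c' ≠ r ∧ ∃ r', CopMove G r r' ∧ safe c' r') :
    ¬ IsCopWin G := by
  rintro ⟨σ, hσ⟩
  choose r0 hr0 using h0
  -- Stated for all positions so that `choose` yields a function; its values at unsafe or illegal
  -- positions do not matter.
  have hnext : ∀ c r c', ∃ r', safe c r → CopMove G c c' → CopMove G r r' ∧ safe c' r' := by
    intro c r c'
    by_cases h : safe c r ∧ CopMove G c c'
    · obtain ⟨-, r', h1, h2⟩ := hstep c r c' h.1 h.2
      exact ⟨r', fun _ _ => ⟨h1, h2⟩⟩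
    · exact ⟨r, fun h1 h2 => absurd ⟨h1, h2⟩ h⟩
  choose next hnext using hnext
  -- The robber's position and the list of his earlier ones are built together, because the cop's
  -- moves depend on the list.
  let play : ℕ → V × List V := fun t => Nat.rec (r0 (σ.pos []), [])
    (fun _ p => (next (σ.pos p.2) p.1 (σ.pos (p.1 :: p.2)), p.1 :: p.2)) t
  have hplay : ∀ t, play (t + 1) = (next (σ.pos (play t).2) (play t).1
    (σ.pos ((play t).1 :: (play t).2)), (play t).1 :: (play t).2) := fun _ => rfl
  have hhist : ∀ t, robberHistory (fun t => (play t).1) t = (play t).2 := by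
    intro t
    induction t with
    | zero => rfl
    | succ t ih => rw [robberHistory_succ, ih, hplay]
  have hsafe : ∀ t, safe (σ.pos (play t).2) (play t).1 := by
    intro t
    induction t with
    | zero => exact hr0 _
    | succ t ih =>
      rw [hplay]
      exact (hnext _ _ _ ih (σ.legal _ _)).2
  obtain ⟨t, ht⟩ := hσ (fun t => (play t).1) fun t => by
    rw [hplay]
    exact (hnext _ _ _ (hsafe t) (σ.legal _ _)).1
  rw [robberHistory_succ, hhist] at ht
  rcases ht with ht | ht
  · exact hne _ _ (hsafe t) ht
  · exact (hstep _ _ _ (hsafe t) (σ.legal _ _)).1 ht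

/-- A graph with a universal vertex is cop-win. -/
lemma isCopWin_of_universal {V : Type*} {G : SimpleGraph V} (u : V)
    (hu : ∀ v, v = u ∨ G.Adj u v) : IsCopWin G := by
  -- The last entry is the robber's first position: the cop starts at `u`, steps onto that position
  -- and stays there.
  let pos : List V → V := fun h => h.getLastD u
  refine ⟨⟨pos, ?_⟩, ?_⟩
  · intro r h
    rcases h with _ | ⟨a, h⟩
    · exact hu r
    · left
      change (a :: h).getLastD r = (a :: h).getLastD u
      rw [List.getLastD_cons, List.getLastD_cons]
  · intro r _
    exact ⟨0, Or.inr rfl⟩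

/-- If there is an uncrossed cut, the robber waits on the side that the cop cannot reach. -/
lemma ConnSet.of_isCopWin {V : Type*} {G : SimpleGraph V} {S : Finset V}
    (h : IsCopWin (G.induce (S : Set V))) : ConnSet G S := by
  intro T hT hne hTS
  by_contra! hcut
  obtain ⟨a, ha⟩ := hne
  obtain ⟨b, hb, hbT⟩ : ∃ b ∈ S, b ∉ T := by
    by_contra! hcon
    exact hTS (hT.antisymm hcon)
  have hmove : ∀ c c' : (S : Set V), CopMove (G.induce (S : Set V)) c c' →
      (c.1 ∈ T ↔ c'.1 ∈ T) := by
    rintro c c' (rfl | hadj)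
    · exact Iff.rfl
    · have hadj' : G.Adj c.1 c'.1 := hadj
      constructor
      · intro h1
        by_contra h2
        exact hcut _ h1 _ c'.2 h2 hadj'
      · intro h1
        by_contra h2
        exact hcut _ h1 _ c.2 h2 hadj'.symm
  refine not_isCopWin_of_safe (fun c r : (S : Set V) => ¬ (c.1 ∈ T ↔ r.1 ∈ T)) ?_ ?_ ?_ h
  · intro c
    by_cases hc : c.1 ∈ T
    · exact ⟨⟨b, hb⟩, by simp [hc, hbT]⟩
    · exact ⟨⟨a, hT ha⟩, by simp [hc, ha]⟩
  · rintro c r hs rfl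
    exact hs Iff.rfl
  · intro c r c' hs hm
    have := hmove c c' hm
    refine ⟨?_, r, Or.inl rfl, by tauto⟩
    rintro rfl
    exact hs this

/-- On a hole whose outside vertices have at most two neighbours on it, the robber escapes
forever. -/
lemma not_isCopWin_of_hole {V : Type*} [DecidableEq V] {G : SimpleGraph V} {S H : Finset V}
    (hH : H ⊆ S) (hhole : Hole G H) (hout : ∀ c ∈ S, c ∉ H → degIn G H c ≤ 2) :
    ¬ IsCopWin (G.induce (S : Set V)) := by
  obtain ⟨a, ha⟩ := hhole.1
  -- The cop cannot guard `r` and its hole neighbours `y` and `z` at once: on the hole she would be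
  -- `y` or `z`, which are not adjacent, and off the hole she would need three neighbours on it.
  have hfree : ∀ c ∈ S, ∀ r ∈ H, c ≠ r →
      ∃ r' ∈ H, (r' = r ∨ G.Adj r r') ∧ r' ≠ c ∧ ¬ G.Adj c r' := by
    intro c hc r hr hcr
    obtain ⟨y, hy, z, hz, hyz, h1, h2, h3, h4⟩ := hhole.2 r hr
    by_contra! hcon
    have hcr' : G.Adj c r := by
      exact hcon r hr (Or.inl rfl) (Ne.symm hcr)
    have hcy : y = c ∨ G.Adj c y := by
      by_contra! h
      exact h.2 (hcon y hy (Or.inr h1) h.1)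
    have hcz : z = c ∨ G.Adj c z := by
      by_contra! h
      exact h.2 (hcon z hz (Or.inr h2) h.1)
    by_cases hcH : c ∈ H
    · rcases h4 c hcH hcr'.symm with rfl | rfl
      · rcases hcz with h | h
        · exact hyz h.symm
        · exact h3 h
      · rcases hcy with h | h
        · exact hyz h
        · exact h3 h.symm
    · have hy' : G.Adj c y := hcy.resolve_left fun h => hcH (h ▸ hy)
      have hz' : G.Adj c z := hcz.resolve_left fun h => hcH (h ▸ hz)
      have hsub : ({r, y, z} : Finset V) ⊆ nbrIn G H c := by
        intro t
        simp only [Finset.mem_insert, Finset.mem_singleton, mem_nbrIn]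
        rintro (rfl | rfl | rfl)
        · exact ⟨hr, hcr'⟩
        · exact ⟨hy, hy'⟩
        · exact ⟨hz, hz'⟩
      have h5 := Finset.card_le_card hsub
      rw [Finset.card_eq_three.2 ⟨r, y, z, h1.ne, h2.ne, hyz, rfl⟩] at h5
      have := hout c hc hcH
      unfold degIn at this
      omega
  have hex : ∀ c ∈ S, ∃ r ∈ H, c ≠ r := by
    intro c _
    obtain ⟨y, hy, z, hz, hyz, h1, -⟩ := hhole.2 a ha
    by_cases hca : c = a
    · exact ⟨y, hy, hca ▸ h1.ne⟩
    · exact ⟨a, ha, hca⟩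
  refine not_isCopWin_of_safe
    (fun c r : (S : Set V) => r.1 ∈ H ∧ r ≠ c ∧ ¬ G.Adj c.1 r.1) ?_ ?_ ?_
  · intro c
    obtain ⟨r, hr, hcr⟩ := hex c.1 c.2
    obtain ⟨r', hr', -, h2, h3⟩ := hfree c.1 c.2 r hr hcr
    exact ⟨⟨r', hH hr'⟩, hr', fun h => h2 (congrArg Subtype.val h), h3⟩
  · rintro c r hs rfl
    exact hs.2.1 rfl
  · rintro c r c' ⟨hr, hrc, hnadj⟩ hm
    have hc'r : c' ≠ r := by
      rintro rfl
      rcases hm with h | h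
      · exact hrc h
      · exact hnadj h
    refine ⟨hc'r, ?_⟩
    obtain ⟨r', hr', h1, h2, h3⟩ := hfree c'.1 c'.2 r.1 hr fun h => hc'r (Subtype.ext h)
    exact ⟨⟨r', hH hr'⟩, h1.imp Subtype.ext id, hr', fun h => h2 (congrArg Subtype.val h), h3⟩

lemma Hole.two_mul_card_le {V : Type*} [DecidableEq V] {G : SimpleGraph V} {H : Finset V}
    (h : Hole G H) : 2 * H.card ≤ degSum G H := by
  have : ∑ x ∈ H, 2 ≤ ∑ x ∈ H, degIn G H x := by
    refine Finset.sum_le_sum fun x hx => ?_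
    obtain ⟨y, hy, z, hz, hyz, h1, h2, -⟩ := h.2 x hx
    unfold degIn
    rw [← Finset.card_pair hyz]
    refine Finset.card_le_card fun t => ?_
    simp only [Finset.mem_insert, Finset.mem_singleton, mem_nbrIn]
    rintro (rfl | rfl)
    · exact ⟨hy, h1⟩
    · exact ⟨hz, h2⟩
  rw [Finset.sum_const, smul_eq_mul] at this
  unfold degSum
  omega

/-- In a bicyclic graph every cop-win set is good. -/
lemma Good.of_isCopWin {V : Type*} [DecidableEq V] {G : SimpleGraph V} {A S : Finset V}
    (hA : ConnSet G A) (hsum : degSum G A = 2 * A.card + 2) (hS : S ⊆ A)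
    (h : IsCopWin (G.induce (S : Set V))) : Good G S := by
  refine ⟨ConnSet.of_isCopWin h, fun H hH hhole => not_isCopWin_of_hole hH hhole ?_ h⟩
  intro c hc hcH
  -- `H` has at least as many edges as vertices. Three further edges for the one vertex `c` would
  -- make an excess of two, while `A` permits only one.
  have h1 := hA.degSum_le (B := insert c H)
    (Finset.insert_subset (hS hc) (hH.trans hS)) (by simp)
  rw [degSum_insert hcH, Finset.card_insert_of_notMem hcH, hsum] at h1
  have := hhole.two_mul_card_le
  omega

lemma copWinCount_le_wcount {V : Type*} [Fintype V] [DecidableEq V] {G : SimpleGraph V}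
    (hconn : ConnSet G Finset.univ) (hsum : degSum G Finset.univ = 2 * Fintype.card V + 2) (k : ℕ) :
    copWinCount G k ≤ wcount G Finset.univ k := by
  classical
  unfold copWinCount wcount
  refine Finset.card_le_card fun S hS => ?_
  rw [Finset.mem_filter] at hS ⊢
  exact ⟨hS.1, Good.of_isCopWin hconn hsum (Finset.subset_univ _) hS.2⟩

end game

/-! ### Upper bounds for the coefficients of a bicyclic graph. -/

section bicyclic_univ
variable {V : Type*} [Fintype V] [DecidableEq V] {G : SimpleGraph V}

lemma connSet_univ (h : G.Connected) : ConnSet G Finset.univ := by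
  intro T _ hne hT
  by_contra! hcut
  obtain ⟨a, ha⟩ := hne
  obtain ⟨b, hb⟩ : ∃ b, b ∉ T := by
    by_contra! hcon
    exact hT (Finset.eq_univ_iff_forall.2 hcon)
  have hwalk : ∀ x y, G.Walk x y → x ∈ T → y ∈ T := by
    intro x y p
    induction p with
    | nil => exact id
    | cons hadj _ ih =>
      intro hx
      refine ih ?_
      by_contra hn
      exact hcut _ hx _ (Finset.mem_univ _) hn hadj
  obtain ⟨p⟩ := h.preconnected a b
  exact hb (hwalk a b p ha)

lemma degSum_univ : degSum G Finset.univ = 2 * G.edgeSet.ncard := by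
  classical
  have h := G.sum_degrees_eq_twice_card_edges
  rw [← SimpleGraph.coe_edgeFinset, Set.ncard_coe_finset, ← h]
  refine Finset.sum_congr rfl fun x _ => ?_
  unfold degIn
  rw [← SimpleGraph.card_neighborFinset_eq_degree]
  congr 1
  ext y
  simp [mem_nbrIn]

end bicyclic_univ

section counts_bicyclic
variable {V : Type*} [Fintype V] {G : SimpleGraph V}

lemma IsBicyclic.copWinCount_le (hG : IsBicyclic G) (h7 : 7 ≤ Fintype.card V) :
    copWinCount G 1 ≤ Fintype.card V ∧ copWinCount G 2 ≤ Fintype.card V + 1 ∧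
    copWinCount G 3 ≤ (Fintype.card V - 1).choose 2 + 1 ∧
    ∀ k, copWinCount G (k + 4) ≤ (Fintype.card V - 1).choose (k + 3) := by
  classical
  have hconn := connSet_univ hG.1
  have hsum : degSum G Finset.univ = 2 * Fintype.card V + 2 := by
    rw [degSum_univ, hG.2]
    ring
  have hle := copWinCount_le_wcount hconn hsum
  rw [← Finset.card_univ] at hsum h7 ⊢
  refine ⟨?_, ?_, ?_, fun k => (hle _).trans (wcount_bicyclic hconn h7 hsum)⟩
  · exact (hle 1).trans (wcount_le_choose.trans (Nat.choose_one_right _).le)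
  · rw [Finset.card_univ, ← hG.2, ← SimpleGraph.coe_edgeFinset, Set.ncard_coe_finset]
    refine (hle 2).trans ?_
    unfold wcount
    refine (Finset.card_le_card (t := G.edgeFinset.image Sym2.toFinset) fun S hS => ?_).trans
      Finset.card_image_le
    rw [Finset.mem_filter, Finset.mem_powersetCard] at hS
    obtain ⟨⟨-, hc⟩, hg⟩ := hS
    obtain ⟨a, ha⟩ : S.Nonempty := Finset.card_pos.1 (by omega)
    obtain ⟨b, hb, hab⟩ := degIn_pos_iff.1 (hg.1.degIn_pos ha (by omega))
    refine Finset.mem_image.2 ⟨s(a, b), SimpleGraph.mem_edgeFinset.2 hab, ?_⟩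
    refine Finset.eq_of_subset_of_card_le (fun t ht => ?_) ?_
    · rw [Sym2.mem_toFinset, Sym2.mem_iff] at ht
      rcases ht with rfl | rfl <;> assumption
    · rw [hc, Sym2.card_toFinset_of_not_isDiag _ (by simpa using hab.ne)]
  -- The allowance `7 - n` is zero here.
  · refine (hle 3).trans ((wcount_three_bicyclic hconn (Finset.card_pos.1 (by omega)) hsum).1.trans ?_)
    omega

end counts_bicyclic

/-! ### Lower bounds for the coefficients of `graphB`. -/

section graphB
variable {n k : ℕ}

lemma isCopWin_induce_of_universal {V : Type*} {G : SimpleGraph V} {S : Finset V} {u : V}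
    (hu : u ∈ S) (h : ∀ v ∈ S, v = u ∨ G.Adj u v) : IsCopWin (G.induce (S : Set V)) :=
  isCopWin_of_universal ⟨u, hu⟩ fun v => (h v.1 v.2).imp Subtype.ext id

lemma graphB_adj_zero {i j : Fin n} (hi : i.val = 0) (hij : j ≠ i) : (graphB n).Adj i j := by
  rw [graphB, SimpleGraph.fromRel_adj]
  exact ⟨hij.symm, Or.inl (Or.inl hi)⟩

lemma graphB_adj_one {i j : Fin n} (hi : i.val = 1) (hj : j.val = 2 ∨ j.val = 3) :
    (graphB n).Adj i j := by
  rw [graphB, SimpleGraph.fromRel_adj]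
  refine ⟨?_, Or.inl (Or.inr ⟨hi, hj⟩)⟩
  rintro rfl
  omega

/-- The sets containing the universal vertex are cop-win; others may be added. -/
lemma choose_add_card_le_copWinCount (hn : 0 < n) (E : Finset (Finset (Fin n)))
    (hE : ∀ S ∈ E, ⟨0, hn⟩ ∉ S ∧ S.card = k + 1 ∧ IsCopWin ((graphB n).induce (S : Set (Fin n)))) :
    (n - 1).choose k + E.card ≤ copWinCount (graphB n) (k + 1) := by
  classical
  set z : Fin n := ⟨0, hn⟩
  set F := ((Finset.univ.erase z).powersetCard k).image (insert z)
  have hF : F.card = (n - 1).choose k := by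
    rw [Finset.card_image_of_injOn, Finset.card_powersetCard,
      Finset.card_erase_of_mem (Finset.mem_univ _), Finset.card_univ, Fintype.card_fin]
    intro S hS T hT h
    rw [Finset.mem_coe, Finset.mem_powersetCard, Finset.subset_erase] at hS hT
    rw [← Finset.erase_insert hS.1.2, ← Finset.erase_insert hT.1.2, h]
  have hdisj : Disjoint F E := by
    rw [Finset.disjoint_left]
    intro S hS hSE
    obtain ⟨T, -, rfl⟩ := Finset.mem_image.1 hS
    exact (hE _ hSE).1 (Finset.mem_insert_self _ _)
  rw [← hF, ← Finset.card_union_of_disjoint hdisj]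
  unfold copWinCount
  refine Finset.card_le_card fun S hS => ?_
  rw [Finset.mem_filter, Finset.mem_powersetCard]
  rw [Finset.mem_union] at hS
  rcases hS with hS | hS
  · obtain ⟨T, hT, rfl⟩ := Finset.mem_image.1 hS
    rw [Finset.mem_powersetCard, Finset.subset_erase] at hT
    refine ⟨⟨Finset.subset_univ _, by rw [Finset.card_insert_of_notMem hT.1.2, hT.2]⟩,
      isCopWin_induce_of_universal (Finset.mem_insert_self z T) fun v _ => ?_⟩
    by_cases hv : v = z
    · exact Or.inl hv
    · exact Or.inr (graphB_adj_zero rfl hv)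
  · exact ⟨⟨Finset.subset_univ _, (hE S hS).2.1⟩, (hE S hS).2.2⟩

/-- The sets added to those through the universal vertex are the other singletons, the two edges
from `1` to `2` and `3`, and the path formed by these edges. -/
lemma le_copWinCount_graphB (hn : 7 ≤ n) :
    n ≤ copWinCount (graphB n) 1 ∧ n + 1 ≤ copWinCount (graphB n) 2 ∧
    (n - 1).choose 2 + 1 ≤ copWinCount (graphB n) 3 ∧
    ∀ k, (n - 1).choose k ≤ copWinCount (graphB n) (k + 1) := by
  classical
  have hpos : 0 < n := by omega
  set a : Fin n := ⟨1, by omega⟩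
  set b : Fin n := ⟨2, by omega⟩
  set c : Fin n := ⟨3, by omega⟩
  have hab : a ≠ b := by simp [a, b, Fin.ext_iff]
  have hac : a ≠ c := by simp [a, c, Fin.ext_iff]
  have hbc : b ≠ c := by simp [b, c, Fin.ext_iff]
  have hadjb : (graphB n).Adj a b := graphB_adj_one rfl (Or.inl rfl)
  have hadjc : (graphB n).Adj a c := graphB_adj_one rfl (Or.inr rfl)
  have hza : (⟨0, hpos⟩ : Fin n) ≠ a := by simp [a, Fin.ext_iff]
  have hzb : (⟨0, hpos⟩ : Fin n) ≠ b := by simp [b, Fin.ext_iff]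
  have hzc : (⟨0, hpos⟩ : Fin n) ≠ c := by simp [c, Fin.ext_iff]
  refine ⟨?_, ?_, ?_, fun k => ?_⟩
  · have h1 : _ ≤ copWinCount (graphB n) 1 := choose_add_card_le_copWinCount (k := 0) hpos
      (((Finset.univ : Finset (Fin n)).erase ⟨0, hpos⟩).image fun x => {x}) (by
        intro S hS
        obtain ⟨x, hx, rfl⟩ := Finset.mem_image.1 hS
        refine ⟨?_, rfl, isCopWin_induce_of_universal (Finset.mem_singleton_self x) fun v hv =>
          Or.inl (Finset.mem_singleton.1 hv)⟩
        rw [Finset.mem_singleton]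
        exact (Finset.ne_of_mem_erase hx).symm)
    rw [Finset.card_image_of_injective _ Finset.singleton_injective,
      Finset.card_erase_of_mem (Finset.mem_univ _), Finset.card_univ, Fintype.card_fin,
      Nat.choose_zero_right] at h1
    omega
  · have h1 : _ ≤ copWinCount (graphB n) 2 := choose_add_card_le_copWinCount (k := 1) hpos {{a, b}, {a, c}} (by
      intro S hS
      rw [Finset.mem_insert, Finset.mem_singleton] at hS
      rcases hS with rfl | rfl
      · refine ⟨by simp [hza, hzb], Finset.card_pair hab, isCopWin_induce_of_universal (u := a)
          (by simp) fun v hv => ?_⟩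
        rw [Finset.mem_insert, Finset.mem_singleton] at hv
        rcases hv with rfl | rfl
        · exact Or.inl rfl
        · exact Or.inr hadjb
      · refine ⟨by simp [hza, hzc], Finset.card_pair hac, isCopWin_induce_of_universal (u := a)
          (by simp) fun v hv => ?_⟩
        rw [Finset.mem_insert, Finset.mem_singleton] at hv
        rcases hv with rfl | rfl
        · exact Or.inl rfl
        · exact Or.inr hadjc)
    rw [Finset.card_pair (by
      intro h
      have : b ∈ ({a, c} : Finset (Fin n)) := h ▸ by simp
      rw [Finset.mem_insert, Finset.mem_singleton] at this
      rcases this with h | h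
      · exact hab h.symm
      · exact hbc h), Nat.choose_one_right] at h1
    omega
  · have h1 := choose_add_card_le_copWinCount (k := 2) hpos {{a, b, c}} (by
      intro S hS
      rw [Finset.mem_singleton] at hS
      subst hS
      refine ⟨by simp [hza, hzb, hzc], Finset.card_eq_three.2 ⟨a, b, c, hab, hac, hbc, rfl⟩,
        isCopWin_induce_of_universal (u := a) (by simp) fun v hv => ?_⟩
      simp only [Finset.mem_insert, Finset.mem_singleton] at hv
      rcases hv with rfl | rfl | rfl
      · exact Or.inl rfl
      · exact Or.inr hadjb
      · exact Or.inr hadjc)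
    rwa [Finset.card_singleton] at h1
  · exact (Nat.le_add_right _ _).trans (choose_add_card_le_copWinCount hpos ∅ (by simp))

end graphB

/-! ### Comparison of the coefficients. -/

lemma coeff_copWinPolynomial {V : Type*} [Fintype V] (G : SimpleGraph V) (k : ℕ) :
    (copWinPolynomial G).coeff k =
      if k ∈ Finset.Icc 1 (Fintype.card V) then (copWinCount G k : ℤ) else 0 := by
  simp only [copWinPolynomial, finsetSum_coeff, coeff_C_mul_X_pow]
  rw [Finset.sum_ite_eq]

theorem mainTheorem3 {V : Type*} [Fintype V] (G : SimpleGraph V) (n : ℕ) (hn : 7 ≤ n)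
    (hV : Fintype.card V = n) (hG : IsBicyclic G) :
    CoeffLE (copWinPolynomial G) (copWinPolynomial (graphB n)) := by
  obtain ⟨g1, g2, g3, g4⟩ := hG.copWinCount_le (by omega)
  rw [hV] at g1 g2 g3 g4
  obtain ⟨b1, b2, b3, b4⟩ := le_copWinCount_graphB hn
  have hcount : ∀ k, 1 ≤ k → copWinCount G k ≤ copWinCount (graphB n) k := by
    intro k hk
    match k, hk with
    | 1, _ => exact g1.trans b1
    | 2, _ => exact g2.trans b2
    | 3, _ => exact g3.trans b3
    | k + 4, _ => exact (g4 k).trans (b4 (k + 3))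
  constructor
  · have h1 : (copWinPolynomial G).natDegree ≤ n := by
      rw [natDegree_le_iff_coeff_eq_zero]
      intro k hk
      rw [coeff_copWinPolynomial, if_neg]
      rw [Finset.mem_Icc]
      omega
    -- The whole graph `graphB n` is cop-win, so its coefficient at `n` is nonzero.
    refine h1.trans (le_natDegree_of_ne_zero ?_)
    rw [coeff_copWinPolynomial, if_pos (by rw [Finset.mem_Icc, Fintype.card_fin]; omega)]
    have h2 := b4 (n - 1)
    rw [Nat.choose_self, Nat.sub_add_cancel (by omega)] at h2
    exact_mod_cast (show copWinCount (graphB n) n ≠ 0 by omega)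
  · intro k
    rw [coeff_copWinPolynomial, coeff_copWinPolynomial, hV, Fintype.card_fin]
    split_ifs with hk
    · exact_mod_cast hcount k (Finset.mem_Icc.1 hk).1
    · exact le_rfl
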